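/- \textbf{Setting.} A finite set of agents is partitioned into sending sub-networks $1,\dots,S$ and receiving sub-networks $S+1,\dots,S+R$. The weights $a_{\ell k}\ge 0$ (the weight that agent $k$ gives to the data of agent $\ell$) satisfy $\sum_\ell a_{\ell k}=1$ for every $k$. An agent of a sending sub-network gives zero weight to all agents outside its own sub-network; an agent of receiving sub-network $r$ gives zero weight to agents of receiving sub-networks $r'>r$. Inside every sub-network any two agents are joined (in both directions) by a path of positive weights; every sending sub-network contains an agent $k$ with $a_{kk}>0$; every receiving sub-network contains an agent that gives positive weight to some agent outside that sub-network. Let $\Theta$ be a finite set of states, and for each agent $k$ let $Z_k$ be a finite signal space and $L_k(\cdot|\theta)$, $\theta\in\Theta$, probability mass functions on $Z_k$. Each sub-network $v$ has a true state $\theta_v^\circ\in\Theta$; different sub-networks may have different or equal ones. At each time $i\ge 1$ each agent $k$ of sub-network $v$ observes a random signal $\boldsymbol\xi_{k,i}\in Z_k$ with law $L_k(\cdot|\theta_v^\circ)$; the vectors $(\boldsymbol\xi_{k,i})_k$, $i\ge 1$, are independent over time (at a fixed time, the signals of different agents may be dependent). Starting from deterministic priors $\mu_{k,0}$, which are probability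 mass functions on $\Theta$, the beliefs evolve for $i\ge1$ by $$\boldsymbol\psi_{k,i}(\theta)=\frac{\boldsymbol\mu_{k,i-1}(\theta)L_k(\boldsymbol\xi_{k,i}|\theta)}{\sum_{\theta'\in\Theta}\boldsymbol\mu_{k,i-1}(\theta')L_k(\boldsymbol\xi_{k,i}|\theta')},\qquad \boldsymbol\mu_{k,i}(\theta)=\sum_{\ell}a_{\ell k}\boldsymbol\psi_{\ell,i}(\theta)$$ (a quotient with zero denominator being read as $0$). For an agent $k$ of sub-network $v$ let $\Theta_k=\{\theta\in\Theta: L_k(\zeta|\theta)=L_k(\zeta|\theta_v^\circ)\ \forall \zeta\in Z_k\}$ be its set of indistinguishable states. Assume that for every sending sub-network $s$: (i) $\mu_{k,0}(\theta_s^\circ)>0$ for at least one agent $k$ of $s$; (ii) every agent $k$ of $s$ has a prevailing signal, i.e. some $\zeta_k^\circ\in Z_k$ with $L_k(\zeta_k^\circ|\theta_s^\circ)>L_k(\zeta_k^\circ|\theta)$ for all $\theta\in\Theta\setminus\Theta_k$; (iii) $\bigcap_{k\in s}\Theta_k=\{\theta_s^\circ\}$. \textbf{Lemma (Focus on True States of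 $S$ Sub-Networks).} Suppose that $\theta_s^\circ\in\Theta_k$ for every sending sub-network $s\in\{1,\dots,S\}$ and every agent $k$ of every receiving sub-network. Let $\Theta^\bullet=\{\theta_1^\circ,\dots,\theta_S^\circ\}$. Then for every agent $k$ of every receiving sub-network and every $\theta\in\Theta\setminus\Theta^\bullet$, $$\lim_{i\to\infty}\boldsymbol\mu_{k,i}(\theta)=0\quad\text{almost surely.}$$ -/

import Mathlib

open MeasureTheory ProbabilityTheory Filter Topology

/-- A weakly-connected network with set of agents `V`, `S` sending sub-networks and `R` receiving
sub-networks. The entry `A l k` is the weight with which agent `k` scales the data that it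
receives from agent `l`. -/
structure WeakNetwork (V : Type*) [Fintype V] (S R : ℕ) where
  /-- the sub-network to which an agent belongs: `Sum.inl s` is the `s`-th sending one,
  `Sum.inr r` is the `r`-th receiving one -/
  sub : V → Fin S ⊕ Fin R
  /-- the combination matrix -/
  A : Matrix V V ℝ
  nonneg : ∀ l k, 0 ≤ A l k
  /-- `A` is left-stochastic -/
  sum_col : ∀ k, ∑ l, A l k = 1
  /-- agents of a sending sub-network receive data only from their own sub-network -/
  sending_closed : ∀ l k s, sub k = Sum.inl s → sub l ≠ Sum.inl s → A l k = 0
  /-- the receiving sub-networks are ordered so that `A` is block upper triangular -/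
  receiving_upper : ∀ l k r r', sub l = Sum.inr r' → sub k = Sum.inr r → r < r' → A l k = 0
  /-- any two agents of a sub-network are joined, inside of it, by a path of positive weights -/
  connected : ∀ l k, sub l = sub k →
    Relation.ReflTransGen (fun i j => sub i = sub k ∧ sub j = sub k ∧ 0 < A i j) l k
  /-- every sending sub-network has an agent with a self-loop (so that, being also connected, it is
  strongly-connected with a primitive combination matrix) -/
  self_loop : ∀ s, ∃ k, sub k = Sum.inl s ∧ 0 < A k k
  /-- every receiving sub-network does receive data from some agent outside of it; by
  `receiving_upper`, this agent is in a sending or in an earlier receiving sub-network -/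
  receives : ∀ r, ∃ l k, sub k = Sum.inr r ∧ sub l ≠ Sum.inr r ∧ 0 < A l k

/-- The data of social learning over a weakly-connected network: a finite set `Θ` of states, finite
signal spaces `Z k`, likelihood functions `L k θ ζ = L_k(ζ | θ)`, one true state for each
sub-network, and the prior beliefs of the agents. -/
structure SocialModel (V : Type*) [Fintype V] (S R : ℕ) (Θ : Type*) [Fintype Θ]
    (Z : V → Type*) [∀ k, Fintype (Z k)] extends WeakNetwork V S R where
  L : (k : V) → Θ → Z k → ℝ
  /-- `L k θ` is a probability mass function on `Z k` -/
  L_mem : ∀ k θ, L k θ ∈ stdSimplex ℝ (Z k)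
  /-- the true state of each sub-network -/
  truth : Fin S ⊕ Fin R → Θ
  /-- the beliefs of the agents at time `0` -/
  prior : V → Θ → ℝ
  /-- `prior k` is a probability mass function on `Θ` -/
  prior_mem : ∀ k, prior k ∈ stdSimplex ℝ Θ

namespace SocialModel

variable {V : Type*} [Fintype V] {S R : ℕ} {Θ : Type*} [Fintype Θ]
  {Z : V → Type*} [∀ k, Fintype (Z k)]

/-- The set `Θ_k` of the states that agent `k` cannot distinguish from the true state of its own
sub-network. -/
def indist (M : SocialModel V S R Θ Z) (k : V) : Set Θ :=
  {θ | ∀ ζ, M.L k θ ζ = M.L k (M.truth (M.sub k)) ζ}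

/-- The set of the true states of the sending sub-networks. -/
def sendingTruths (M : SocialModel V S R Θ Z) : Set Θ :=
  Set.range fun s : Fin S => M.truth (Sum.inl s)

/-- Bayes' rule: the intermediate belief of agent `k` whose current belief is `μ` and who observes
the signal `ζ`. -/
noncomputable def bayes (M : SocialModel V S R Θ Z) (k : V) (μ : Θ → ℝ) (ζ : Z k) : Θ → ℝ :=
  fun θ => μ θ * M.L k θ ζ / ∑ θ', μ θ' * M.L k θ' ζ

/-- The diffusion strategy: `M.belief x i k θ` is the belief `μ_{k,i}(θ)` when each agent `l`
observes the signal `x j l` at each time `j ≥ 1`. -/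
noncomputable def belief (M : SocialModel V S R Θ Z) (x : ℕ → (k : V) → Z k) : ℕ → V → Θ → ℝ
  | 0 => M.prior
  | i + 1 => fun k θ => ∑ l, M.A l k * M.bayes l (M.belief x i l) (x (i + 1) l) θ

/-- `ξ i ω k` is the signal of agent `k` at time `i ≥ 1`: it has the law `L_k(· | θ°)`, where `θ°`
is the true state of the sub-network of `k`, and the signals are independent over time. Nothing is
assumed on the joint law of the signals of different agents at the same time. -/
structure IsSignalSequence (M : SocialModel V S R Θ Z) [∀ k, MeasurableSpace (Z k)]
    {Ω : Type*} [MeasurableSpace Ω] (P : Measure Ω) (ξ : ℕ → Ω → (k : V) → Z k) : Prop where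
  measurable : ∀ i, 1 ≤ i → Measurable (ξ i)
  law : ∀ i, 1 ≤ i → ∀ k ζ, P.real {ω | ξ i ω k = ζ} = M.L k (M.truth (M.sub k)) ζ
  indep : iIndepFun (fun i => ξ (i + 1)) P

/-- `ζ` is a prevailing signal of agent `k`: it is more likely under the true state of the
sub-network of `k` than under every state that `k` can distinguish from it. -/
def IsPrevailing (M : SocialModel V S R Θ Z) (k : V) (ζ : Z k) : Prop :=
  ∀ θ, θ ∉ M.indist k → M.L k θ ζ < M.L k (M.truth (M.sub k)) ζ

end SocialModel

/-! Give each agent a target set: its own true state for a sending agent, `sendingTruths` for a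
receiving one. States in the target explain an agent's data exactly as well as the truth, and
targets grow along arcs. Let `err` be the mass missing from the target; it also counts mass lost
through zero denominators, so beliefs are treated as subprobabilities. It suffices to show that
`err` tends to 0 almost surely.

A Bayes step does not increase the expected error (`sum_trueL_mul_one_sub_bayes_le`) and pathwise
multiplies it by at most `2 / ε` (`one_sub_bayes_le`). Hence the moments of order `1 + β` satisfy a
linear recursion with matrix `A` and loss `(2 / ε) ^ β`. On receiving agents `A` is a strict
contraction (`exists_contraction`), so for small `β` the loss is absorbed, and the moments of all
agents are summable as soon as those of the sending agents are (`IsSignalSequence.ae_tendsto_err`).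
Summable moments give almost sure convergence.

For a sending sub-network with Perron vector `p` and true state `θ°`, consider `X = ∑ p k * (μ k θ°
^ (-1/2) - 1)`. By a Hellinger estimate at the prevailing signals, and by convexity for the
diffusion step, `X` decreases in the mean by a multiple of `∑ p l * distMass l ^ 2`. Used alone this
gives only second moments of the error. The concave function `X + X ^ β` weights the decrease by `1
+ β * X ^ (β - 1)`. Its expected decreases telescope, and by identifiability they control `err ^ (1
+ β)` a bounded number of steps earlier (`IsPerron.totalErr_rpow_le`). This covers every `β` in `(0,
1)`, hence the small `β` that the receiving agents need. -/

theorem exists_pos_le_of_finite {ι : Type*} [Finite ι] (f : ι → ℝ) :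
    ∃ ε, 0 < ε ∧ ε ≤ 1 ∧ ∀ i, 0 < f i → ε ≤ f i := by
  classical
  -- The extra point `none`, of value 1, makes the index type nonempty and caps the minimum at 1.
  obtain ⟨o, ho⟩ := Finite.exists_min
    (fun o : Option ι => o.elim (1 : ℝ) fun i => if 0 < f i then f i else 1)
  refine ⟨_, ?_, ho none, fun i hi => ?_⟩
  · cases o with
    | none => simp
    | some i => simp only [Option.elim_some]; split_ifs with h <;> simp_all
  · simpa [hi] using ho (some i)

/-! ### One Bayes step on a subprobability vector. -/

namespace SocialModel

variable {V : Type*} [Fintype V] {S R : ℕ} {Θ : Type*} [Fintype Θ]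
  {Z : V → Type*} [∀ k, Fintype (Z k)] (M : SocialModel V S R Θ Z)

/-- The true law of the signals of agent `k`. -/
def trueL (k : V) (ζ : Z k) : ℝ := M.L k (M.truth (M.sub k)) ζ

/-- The probability that agent `k` with belief `μ` assigns to the signal `ζ`. -/
def evidence (k : V) (μ : Θ → ℝ) (ζ : Z k) : ℝ := ∑ θ, μ θ * M.L k θ ζ

theorem bayes_eq (k : V) (μ : Θ → ℝ) (ζ : Z k) (θ : Θ) :
    M.bayes k μ ζ θ = μ θ * M.L k θ ζ / M.evidence k μ ζ := rfl

theorem L_nonneg (k : V) (θ : Θ) (ζ : Z k) : 0 ≤ M.L k θ ζ := (M.L_mem k θ).1 ζ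

theorem L_le_one (k : V) (θ : Θ) (ζ : Z k) : M.L k θ ζ ≤ 1 := by
  rw [← (M.L_mem k θ).2]
  exact Finset.single_le_sum (fun z _ => M.L_nonneg k θ z) (Finset.mem_univ ζ)

theorem trueL_nonneg (k : V) (ζ : Z k) : 0 ≤ M.trueL k ζ := M.L_nonneg _ _ _

theorem trueL_le_one (k : V) (ζ : Z k) : M.trueL k ζ ≤ 1 := M.L_le_one _ _ _

theorem sum_trueL (k : V) : ∑ ζ, M.trueL k ζ = 1 := (M.L_mem k _).2

/-- A nonnegative vector of total mass at most one. -/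
def IsSubProb (μ : Θ → ℝ) : Prop := (∀ θ, 0 ≤ μ θ) ∧ ∑ θ, μ θ ≤ 1

variable {M} {k : V} {μ : Θ → ℝ} {T : Finset Θ} {ζ : Z k}

theorem IsSubProb.sum_nonneg (h : IsSubProb μ) (T : Finset Θ) : 0 ≤ ∑ θ ∈ T, μ θ :=
  Finset.sum_nonneg fun θ _ => h.1 θ

theorem IsSubProb.sum_le_one (h : IsSubProb μ) (T : Finset Θ) : ∑ θ ∈ T, μ θ ≤ 1 :=
  (Finset.sum_le_sum_of_subset_of_nonneg (Finset.subset_univ T) fun θ _ _ => h.1 θ).trans h.2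

theorem IsSubProb.le_one (h : IsSubProb μ) (θ : Θ) : μ θ ≤ 1 := by
  simpa using h.sum_le_one {θ}

theorem evidence_nonneg (h : IsSubProb μ) (ζ : Z k) : 0 ≤ M.evidence k μ ζ :=
  Finset.sum_nonneg fun θ _ => mul_nonneg (h.1 θ) (M.L_nonneg k θ ζ)

theorem evidence_le_one (h : IsSubProb μ) (ζ : Z k) : M.evidence k μ ζ ≤ 1 :=
  (Finset.sum_le_sum fun θ _ => mul_le_of_le_one_right (h.1 θ) (M.L_le_one k θ ζ)).trans h.2

theorem sum_evidence_le_one (h : IsSubProb μ) : ∑ ζ, M.evidence k μ ζ ≤ 1 := by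
  unfold evidence
  rw [Finset.sum_comm]
  simp_rw [← Finset.mul_sum, (M.L_mem k _).2, mul_one]
  exact h.2

theorem mul_L_le_evidence (h : IsSubProb μ) (θ : Θ) (ζ : Z k) :
    μ θ * M.L k θ ζ ≤ M.evidence k μ ζ :=
  Finset.single_le_sum (f := fun θ => μ θ * M.L k θ ζ)
    (fun θ _ => mul_nonneg (h.1 θ) (M.L_nonneg k θ ζ)) (Finset.mem_univ θ)

theorem bayes_nonneg (h : IsSubProb μ) (ζ : Z k) (θ : Θ) : 0 ≤ M.bayes k μ ζ θ :=
  div_nonneg (mul_nonneg (h.1 θ) (M.L_nonneg k θ ζ)) (evidence_nonneg h ζ)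

theorem sum_bayes_eq_one (h : M.evidence k μ ζ ≠ 0) : ∑ θ, M.bayes k μ ζ θ = 1 := by
  simp_rw [bayes_eq, ← Finset.sum_div]
  exact div_self h

theorem isSubProb_bayes (h : IsSubProb μ) (ζ : Z k) : IsSubProb (M.bayes k μ ζ) := by
  refine ⟨bayes_nonneg h ζ, ?_⟩
  by_cases h0 : M.evidence k μ ζ = 0
  · simp [bayes_eq, h0]
  · exact (sum_bayes_eq_one h0).le

theorem sum_bayes_of_forall_mem (hT : ∀ θ ∈ T, M.L k θ ζ = M.trueL k ζ) :
    ∑ θ ∈ T, M.bayes k μ ζ θ = (∑ θ ∈ T, μ θ) * M.trueL k ζ / M.evidence k μ ζ := by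
  simp_rw [bayes_eq, ← Finset.sum_div]
  rw [Finset.sum_mul, Finset.sum_congr rfl fun θ hθ => by rw [hT θ hθ]]

theorem sum_mul_trueL_le_evidence (h : IsSubProb μ) (hT : ∀ θ ∈ T, M.L k θ ζ = M.trueL k ζ) :
    (∑ θ ∈ T, μ θ) * M.trueL k ζ ≤ M.evidence k μ ζ := by
  rw [Finset.sum_mul, Finset.sum_congr rfl fun θ hθ => by rw [← hT θ hθ]]
  exact Finset.sum_le_sum_of_subset_of_nonneg (Finset.subset_univ T)
    fun θ _ _ => mul_nonneg (h.1 θ) (M.L_nonneg k θ ζ)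

theorem evidence_sub_le (h : IsSubProb μ) (hT : ∀ θ ∈ T, M.L k θ ζ = M.trueL k ζ) :
    M.evidence k μ ζ - (∑ θ ∈ T, μ θ) * M.trueL k ζ ≤ 1 - ∑ θ ∈ T, μ θ := by
  classical
  have h1 : M.evidence k μ ζ =
      ∑ θ ∈ T, μ θ * M.L k θ ζ + ∑ θ ∈ Tᶜ, μ θ * M.L k θ ζ :=
    (Finset.sum_add_sum_compl T _).symm
  have h2 := Finset.sum_add_sum_compl T μ
  have h3 : ∑ θ ∈ Tᶜ, μ θ * M.L k θ ζ ≤ ∑ θ ∈ Tᶜ, μ θ :=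
    Finset.sum_le_sum fun θ _ => mul_le_of_le_one_right (h.1 θ) (M.L_le_one k θ ζ)
  have h4 : (∑ θ ∈ T, μ θ) * M.trueL k ζ = ∑ θ ∈ T, μ θ * M.L k θ ζ := by
    rw [Finset.sum_mul, Finset.sum_congr rfl fun θ hθ => by rw [← hT θ hθ]]
  linarith [h.2]

/-- In the mean, Bayes' rule does not decrease the belief in a set of states that explain the
data as well as the truth does. -/
theorem sum_trueL_mul_one_sub_bayes_le (h : IsSubProb μ)
    (hT : ∀ θ ∈ T, ∀ ζ, M.L k θ ζ = M.trueL k ζ) :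
    ∑ ζ, M.trueL k ζ * (1 - ∑ θ ∈ T, M.bayes k μ ζ θ) ≤ 1 - ∑ θ ∈ T, μ θ := by
  set q := ∑ θ ∈ T, μ θ with hq
  have hq0 : 0 ≤ q := h.sum_nonneg T
  -- With `L` the true likelihood and `m` the evidence, this is `q * L ^ 2 / m ≥ q * (2 * L - m)`,
  -- that is `(L - m) ^ 2 ≥ 0`. Summing over the signals leaves at least `q * (2 - 1)`.
  have key : ∀ ζ, q * (2 * M.trueL k ζ - M.evidence k μ ζ) ≤
      M.trueL k ζ * ∑ θ ∈ T, M.bayes k μ ζ θ := by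
    intro ζ
    have hT' : ∀ θ ∈ T, M.L k θ ζ = M.trueL k ζ := fun θ hθ => hT θ hθ ζ
    rw [sum_bayes_of_forall_mem hT', ← hq]
    have h1 := sum_mul_trueL_le_evidence h hT'
    rw [← hq] at h1
    rcases (evidence_nonneg (M := M) h ζ).eq_or_lt with h0 | h0
    · rw [← h0] at h1 ⊢
      have := mul_nonneg hq0 (M.trueL_nonneg k ζ)
      simp only [div_zero, mul_zero, sub_zero]
      linarith
    · rw [mul_div_assoc', le_div_iff₀ h0]
      nlinarith [mul_nonneg hq0 (sq_nonneg (M.trueL k ζ - M.evidence k μ ζ))]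
  have h2 := Finset.sum_le_sum fun ζ (_ : ζ ∈ Finset.univ) => key ζ
  rw [← Finset.mul_sum, Finset.sum_sub_distrib, ← Finset.mul_sum, sum_trueL] at h2
  simp_rw [mul_sub, Finset.sum_sub_distrib, mul_one, sum_trueL]
  have h3 := sum_evidence_le_one (M := M) (k := k) h
  nlinarith

/-- One application of Bayes' rule to a signal of probability at least `ε` increases the lack of
belief in such a set of states by a factor `2 / ε` at most. -/
theorem one_sub_bayes_le {ε : ℝ} (h : IsSubProb μ) (hT : ∀ θ ∈ T, M.L k θ ζ = M.trueL k ζ)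
    (hε : 0 < ε) (hε' : ε ≤ M.trueL k ζ) :
    1 - ∑ θ ∈ T, M.bayes k μ ζ θ ≤ 2 / ε * (1 - ∑ θ ∈ T, μ θ) := by
  have hε1 : ε ≤ 1 := hε'.trans (M.trueL_le_one k ζ)
  have hb : 0 ≤ ∑ θ ∈ T, M.bayes k μ ζ θ := (isSubProb_bayes h ζ).sum_nonneg T
  have hq1 := h.sum_le_one T
  have h1 := sum_mul_trueL_le_evidence h hT
  have h2 := evidence_sub_le h hT
  rw [sum_bayes_of_forall_mem hT] at hb ⊢
  set q := ∑ θ ∈ T, μ θ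
  rw [div_mul_eq_mul_div, le_div_iff₀ hε]
  -- If `q ≤ 1 / 2`, the right side is already at least 1. Otherwise the evidence is at least `ε /
  -- 2`, and the new error is at most `(1 - q)` divided by it.
  rcases le_total q (1 / 2) with hq | hq
  · nlinarith
  · have hm : q * ε ≤ M.evidence k μ ζ := (mul_le_mul_of_nonneg_left hε' (by linarith)).trans h1
    have hm0 : 0 < M.evidence k μ ζ := lt_of_lt_of_le (by positivity) hm
    rw [← mul_le_mul_iff_left₀ hm0]
    have e : (1 - q * M.trueL k ζ / M.evidence k μ ζ) * ε * M.evidence k μ ζ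
        = (M.evidence k μ ζ - q * M.trueL k ζ) * ε := by field_simp
    rw [e]
    have : (1 - q) * ε ≤ 2 * (1 - q) * (q * ε) := by
      have : 0 ≤ (1 - q) * ε := mul_nonneg (by linarith) hε.le
      nlinarith
    have h5 : 0 ≤ 2 * (1 - q) := by linarith
    nlinarith [mul_le_mul_of_nonneg_left hm h5]

/-! ### Target sets and the propagation of the error through the network. -/

variable (M)

theorem belief_succ (x : ℕ → (k : V) → Z k) (i : ℕ) (k : V) (θ : Θ) :
    M.belief x (i + 1) k θ = ∑ l, M.A l k * M.bayes l (M.belief x i l) (x (i + 1) l) θ := rfl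

theorem sum_belief_succ (x : ℕ → (k : V) → Z k) (i : ℕ) (k : V) (T : Finset Θ) :
    ∑ θ ∈ T, M.belief x (i + 1) k θ =
      ∑ l, M.A l k * ∑ θ ∈ T, M.bayes l (M.belief x i l) (x (i + 1) l) θ := by
  simp_rw [belief_succ, Finset.mul_sum]
  exact Finset.sum_comm

theorem isSubProb_belief (x : ℕ → (k : V) → Z k) (i : ℕ) (k : V) :
    IsSubProb (M.belief x i k) := by
  induction i generalizing k with
  | zero => exact ⟨(M.prior_mem k).1, (M.prior_mem k).2.le⟩
  | succ i ih =>
    refine ⟨fun θ => Finset.sum_nonneg fun l _ =>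
      mul_nonneg (M.nonneg l k) (bayes_nonneg (ih l) _ θ), ?_⟩
    rw [sum_belief_succ, ← M.sum_col k]
    exact Finset.sum_le_sum fun l _ =>
      mul_le_of_le_one_right (M.nonneg l k) (isSubProb_bayes (ih l) _).2

/-- All the signals have positive probability. -/
def Feasible (x : ℕ → (k : V) → Z k) : Prop := ∀ j, 1 ≤ j → ∀ k, 0 < M.trueL k (x j k)

theorem exists_pos_le_trueL :
    ∃ ε, 0 < ε ∧ ε ≤ 1 ∧ ∀ k ζ, 0 < M.trueL k ζ → ε ≤ M.trueL k ζ := by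
  obtain ⟨ε, h0, h1, h⟩ := exists_pos_le_of_finite fun z : Σ k, Z k => M.trueL z.1 z.2
  exact ⟨ε, h0, h1, fun k ζ => h ⟨k, ζ⟩⟩

open Classical in
/-- The states on which the beliefs of agent `k` will concentrate. -/
noncomputable def target (k : V) : Finset Θ :=
  match M.sub k with
  | Sum.inl s => {M.truth (Sum.inl s)}
  | Sum.inr _ => Finset.univ.image fun s : Fin S => M.truth (Sum.inl s)

theorem target_of_sending {k : V} {s : Fin S} (hk : M.sub k = Sum.inl s) :
    M.target k = {M.truth (Sum.inl s)} := by
  simp [target, hk]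

theorem mem_target_of_receiving {k : V} {r : Fin R} (hk : M.sub k = Sum.inr r) {θ : Θ} :
    θ ∈ M.target k ↔ θ ∈ M.sendingTruths := by
  simp [target, hk, sendingTruths]

/-- This inclusion is what makes diffusion average errors: mass in the target of a neighbour counts
as mass in the agent's own target. -/
theorem target_subset {l k : V} (h : 0 < M.A l k) : M.target l ⊆ M.target k := by
  intro θ hθ
  rcases hk : M.sub k with s | r
  · by_cases hl : M.sub l = Sum.inl s
    · rwa [target_of_sending M hl, ← target_of_sending M hk] at hθ
    · exact absurd (M.sending_closed l k s hk hl) h.ne'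
  · rw [mem_target_of_receiving M hk]
    rcases hl : M.sub l with s | r'
    · rw [target_of_sending M hl, Finset.mem_singleton] at hθ
      exact ⟨s, hθ.symm⟩
    · rwa [mem_target_of_receiving M hl] at hθ

theorem L_eq_of_mem_target (himp : ∀ (r : Fin R) (k : V), M.sub k = Sum.inr r →
    ∀ s : Fin S, M.truth (Sum.inl s) ∈ M.indist k) {k : V} {θ : Θ} (hθ : θ ∈ M.target k)
    (ζ : Z k) : M.L k θ ζ = M.trueL k ζ := by
  rcases hk : M.sub k with s | r
  · rw [target_of_sending M hk, Finset.mem_singleton] at hθ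
    rw [hθ, trueL, hk]
  · obtain ⟨s, rfl⟩ := (mem_target_of_receiving M hk).1 hθ
    exact himp r k hk s ζ

/-- The belief of agent `k` that is missing from its target set. -/
noncomputable def err (x : ℕ → (k : V) → Z k) (i : ℕ) (k : V) : ℝ :=
  1 - ∑ θ ∈ M.target k, M.belief x i k θ

theorem err_nonneg (x : ℕ → (k : V) → Z k) (i : ℕ) (k : V) : 0 ≤ M.err x i k :=
  sub_nonneg.2 ((M.isSubProb_belief x i k).sum_le_one _)

theorem err_le_one (x : ℕ → (k : V) → Z k) (i : ℕ) (k : V) : M.err x i k ≤ 1 :=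
  sub_le_self _ ((M.isSubProb_belief x i k).sum_nonneg _)

theorem belief_le_err (x : ℕ → (k : V) → Z k) (i : ℕ) (k : V) {θ : Θ} (hθ : θ ∉ M.target k) :
    M.belief x i k θ ≤ M.err x i k := by
  have h := (M.isSubProb_belief x i k).sum_le_one (Finset.cons θ _ hθ)
  rw [Finset.sum_cons] at h
  unfold err
  linarith

theorem err_succ_le (x : ℕ → (k : V) → Z k) (i : ℕ) (k : V) :
    M.err x (i + 1) k ≤ ∑ l, M.A l k *
      (1 - ∑ θ ∈ M.target l, M.bayes l (M.belief x i l) (x (i + 1) l) θ) := by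
  simp_rw [err, sum_belief_succ, mul_sub, Finset.sum_sub_distrib, mul_one, M.sum_col]
  refine sub_le_sub_left (Finset.sum_le_sum fun l _ => ?_) _
  rcases (M.nonneg l k).eq_or_lt with h | h
  · simp [← h]
  · exact mul_le_mul_of_nonneg_left (Finset.sum_le_sum_of_subset_of_nonneg (M.target_subset h)
      fun θ _ _ => bayes_nonneg (M.isSubProb_belief x i l) _ θ) h.le

end SocialModel

/-! ### Functionals of finitely many signals and averaging over the next signal. -/

/-- By Tonelli the series of the `f i` has finite integral, so it converges almost surely. -/
theorem ae_tendsto_zero_of_summable_integral {Ω : Type*} [MeasurableSpace Ω] {P : Measure Ω}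
    {f : ℕ → Ω → ℝ} (hf : ∀ i ω, 0 ≤ f i ω) (hint : ∀ i, Integrable (f i) P)
    (hsum : Summable fun i => ∫ ω, f i ω ∂P) :
    ∀ᵐ ω ∂P, Tendsto (fun i => f i ω) atTop (𝓝 0) := by
  have hm : ∀ i, AEMeasurable (fun ω => ENNReal.ofReal (f i ω)) P :=
    fun i => (hint i).1.aemeasurable.ennreal_ofReal
  have h1 : ∫⁻ ω, ∑' i, ENNReal.ofReal (f i ω) ∂P ≠ ⊤ := by
    rw [lintegral_tsum hm]
    simp_rw [← ofReal_integral_eq_lintegral_ofReal (hint _) (ae_of_all _ (hf _))]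
    rw [← ENNReal.ofReal_tsum_of_nonneg (fun i => integral_nonneg (hf i)) hsum]
    exact ENNReal.ofReal_ne_top
  filter_upwards [ae_lt_top' (AEMeasurable.tsum hm) h1] with ω hω
  have h2 := ENNReal.tendsto_atTop_zero_of_tsum_ne_top hω.ne
  have h3 := (ENNReal.tendsto_toReal ENNReal.zero_ne_top).comp h2
  simpa [Function.comp_def, ENNReal.toReal_ofReal (hf _ ω)] using h3

/-- `F` is a function of the terms `1, …, n` of a sequence. -/
def PathAdapted {E : Type*} (n : ℕ) (F : (ℕ → E) → ℝ) : Prop :=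
  ∀ x y, (∀ j, 1 ≤ j → j ≤ n → x j = y j) → F x = F y

theorem PathAdapted.mono {E : Type*} {m n : ℕ} {F : (ℕ → E) → ℝ} (h : PathAdapted m F) (hmn : m ≤ n) :
    PathAdapted n F := fun x y hxy => h x y fun j h1 h2 => hxy j h1 (h2.trans hmn)

/-- Factoring through a finite product reduces measurability to that of the signals at times `≥ 1`;
nothing is assumed on the term of index 0. -/
theorem PathAdapted.exists_eq {E : Type*} [Nonempty E] {n : ℕ} {F : (ℕ → E) → ℝ} (h : PathAdapted n F) :
    ∃ g : (Finset.range n → E) → ℝ, ∀ x, F x = g fun j => x (j + 1) := by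
  classical
  obtain ⟨e⟩ := ‹Nonempty E›
  refine ⟨fun y => F fun j =>
    if hj : j - 1 ∈ Finset.range n then y ⟨j - 1, hj⟩ else e, fun x => h _ _ fun j h1 h2 => ?_⟩
  have : j - 1 ∈ Finset.range n := Finset.mem_range.2 (by omega)
  simp only [this, dite_true]
  congr 1
  omega

section

variable {Ω : Type*} [MeasurableSpace Ω] {P : Measure Ω} [IsProbabilityMeasure P]
  {E : Type*} [Finite E] [MeasurableSpace E] [MeasurableSingletonClass E] {ξ : ℕ → Ω → E}

/-- There are finitely many histories of length `n`, so no bound is needed, even for inverse square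
roots of beliefs. -/
theorem PathAdapted.integrable (hξ : ∀ i, 1 ≤ i → Measurable (ξ i)) {n : ℕ} {F : (ℕ → E) → ℝ}
    (h : PathAdapted n F) : Integrable (fun ω => F fun j => ξ j ω) P := by
  have : Nonempty E := (nonempty_of_isProbabilityMeasure P).map (ξ 0)
  obtain ⟨g, hg⟩ := h.exists_eq
  simp_rw [hg]
  have hH : Measurable fun ω (j : Finset.range n) => ξ (j + 1) ω :=
    measurable_pi_lambda _ fun j => hξ _ (by omega)
  have : IsFiniteMeasure (P.map fun ω (j : Finset.range n) => ξ (j + 1) ω) := inferInstance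
  exact (Integrable.of_finite (f := g)).comp_measurable hH

theorem PathAdapted.integral_indicator_mul (hξ : ∀ i, 1 ≤ i → Measurable (ξ i))
    (hind : iIndepFun (fun i => ξ (i + 1)) P) {n : ℕ} {F : (ℕ → E) → ℝ} (h : PathAdapted n F)
    (f : E → ℝ) :
    ∫ ω, f (ξ (n + 1) ω) * F (fun j => ξ j ω) ∂P =
      (∫ ω, f (ξ (n + 1) ω) ∂P) * ∫ ω, F (fun j => ξ j ω) ∂P := by
  have : Nonempty E := (nonempty_of_isProbabilityMeasure P).map (ξ 0)
  obtain ⟨g, hg⟩ := h.exists_eq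
  simp_rw [hg]
  have hi := hind.indepFun_finset {n} (Finset.range n) (by simp) fun i => hξ _ (by omega)
  have hi' := hi.comp (φ := fun y => f (y ⟨n, by simp⟩)) (ψ := g)
    (measurable_of_finite _) (measurable_of_finite _)
  exact hi'.integral_fun_mul_eq_mul_integral
    ((measurable_of_finite f).comp (hξ _ (by omega))).aestronglyMeasurable
    ((measurable_of_finite g).comp
      (measurable_pi_lambda _ fun j => hξ _ (by omega))).aestronglyMeasurable

end

namespace SocialModel

variable {V : Type*} [Fintype V] {S R : ℕ} {Θ : Type*} [Fintype Θ]
  {Z : V → Type*} [∀ k, Fintype (Z k)] {M : SocialModel V S R Θ Z}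

theorem belief_congr {n : ℕ} {x y : ℕ → (k : V) → Z k}
    (h : ∀ j, 1 ≤ j → j ≤ n → x j = y j) : M.belief x n = M.belief y n := by
  induction n with
  | zero => rfl
  | succ n ih =>
    ext k θ
    rw [belief_succ, belief_succ, ih fun j h1 h2 => h j h1 (by omega),
      h (n + 1) (by omega) le_rfl]

theorem adapted_belief (n : ℕ) (f : (V → Θ → ℝ) → ℝ) : PathAdapted n fun x => f (M.belief x n) :=
  fun _ _ h => congrArg f (belief_congr h)

variable [∀ k, MeasurableSpace (Z k)]
  {Ω : Type*} [MeasurableSpace Ω] {P : Measure Ω} [IsProbabilityMeasure P]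
  {ξ : ℕ → Ω → (k : V) → Z k}

theorem IsSignalSequence.ae_feasible (hξ : M.IsSignalSequence P ξ) :
    ∀ᵐ ω ∂P, M.Feasible fun j => ξ j ω := by
  refine ae_all_iff.2 fun j => ?_
  by_cases hj : 1 ≤ j
  swap
  · simp [hj]
  have : ∀ᵐ ω ∂P, ∀ k ζ, ξ j ω k = ζ → 0 < M.trueL k ζ := by
    refine ae_all_iff.2 fun k => ae_all_iff.2 fun ζ => ?_
    by_cases h0 : 0 < M.trueL k ζ
    · simp [h0]
    · have h1 : M.trueL k ζ = 0 := le_antisymm (not_lt.1 h0) (M.trueL_nonneg k ζ)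
      have h2 := hξ.law j hj k ζ
      change _ = M.trueL k ζ at h2
      rw [h1, measureReal_eq_zero_iff] at h2
      simpa [ae_iff, h0] using h2
  filter_upwards [this] with ω hω _ k
  exact hω k _ rfl

variable [∀ k, MeasurableSingletonClass (Z k)]

theorem IsSignalSequence.integrable (hξ : M.IsSignalSequence P ξ) {n : ℕ}
    {F : (ℕ → (k : V) → Z k) → ℝ} (h : PathAdapted n F) :
    Integrable (fun ω => F fun j => ξ j ω) P :=
  h.integrable hξ.measurable

/-- The signal of agent `l` at time `n + 1` is independent of the past, and has the law
`M.trueL l`. -/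
theorem IsSignalSequence.integral_step (hξ : M.IsSignalSequence P ξ) (l : V) {n : ℕ}
    {G : Z l → (ℕ → (k : V) → Z k) → ℝ} (h : ∀ ζ, PathAdapted n (G ζ)) :
    ∫ ω, G (ξ (n + 1) ω l) (fun j => ξ j ω) ∂P =
      ∫ ω, ∑ ζ, M.trueL l ζ * G ζ (fun j => ξ j ω) ∂P := by
  classical
  let f : Z l → ((k : V) → Z k) → ℝ := fun ζ z => if z l = ζ then 1 else 0
  have h1 : ∀ ω, G (ξ (n + 1) ω l) (fun j => ξ j ω) =
      ∑ ζ, f ζ (ξ (n + 1) ω) * G ζ (fun j => ξ j ω) := by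
    intro ω
    simp [f]
  simp_rw [h1]
  have hf : ∀ ζ, ∫ ω, f ζ (ξ (n + 1) ω) ∂P = M.trueL l ζ := by
    intro ζ
    have hs : MeasurableSet {ω | ξ (n + 1) ω l = ζ} :=
      ((measurable_pi_apply l).comp (hξ.measurable (n + 1) (by omega)))
        (measurableSet_singleton ζ)
    rw [trueL, ← hξ.law (n + 1) (by omega) l ζ, ← integral_indicator_one hs]
    rfl
  have hi : ∀ ζ, Integrable (fun ω => f ζ (ξ (n + 1) ω) * G ζ (fun j => ξ j ω)) P := by
    intro ζ
    refine hξ.integrable (n := n + 1) (F := fun x => f ζ (x (n + 1)) * G ζ x) fun x y hxy => ?_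
    beta_reduce
    rw [hxy (n + 1) (by omega) le_rfl, (h ζ).mono (Nat.le_succ n) x y hxy]
  rw [integral_finsetSum _ fun ζ _ => hi ζ,
    integral_finsetSum _ fun ζ _ => (hξ.integrable (h ζ)).const_mul _]
  refine Finset.sum_congr rfl fun ζ _ => ?_
  rw [(h ζ).integral_indicator_mul hξ.measurable hξ.indep, hf, integral_const_mul]

end SocialModel

/-! ### Receiving agents: contraction and summable moments. -/

namespace SocialModel

variable {V : Type*} [Fintype V] {S R : ℕ} {Θ : Type*} [Fintype Θ]
  {Z : V → Type*} [∀ k, Fintype (Z k)] {M : SocialModel V S R Θ Z}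

theorem exists_le_A (M : SocialModel V S R Θ Z) :
    ∃ a, 0 < a ∧ a ≤ 1 ∧ ∀ l k, 0 < M.A l k → a ≤ M.A l k := by
  obtain ⟨a, h0, h1, h⟩ := exists_pos_le_of_finite fun z : V × V => M.A z.1 z.2
  exact ⟨a, h0, h1, fun l k => h (l, k)⟩

/-- A set that contains the sending agents and that is closed under the arcs of the network
contains all the agents. -/
theorem mem_of_closed (M : SocialModel V S R Θ Z) (p : V → Prop)
    (hs : ∀ k s, M.sub k = Sum.inl s → p k) (hA : ∀ l k, 0 < M.A l k → p l → p k) (k : V) :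
    p k := by
  rcases hk : M.sub k with s | r
  · exact hs k s hk
  induction r using WellFoundedLT.induction generalizing k with
  | _ r ih =>
    obtain ⟨l, k', hk', hl, hlk⟩ := M.receives r
    have hpl : p l := by
      rcases hl' : M.sub l with s | r'
      · exact hs l s hl'
      · refine ih r' (lt_of_le_of_ne (not_lt.1 fun hlt => ?_) fun h => hl (h ▸ hl')) l hl'
        exact hlk.ne' (M.receiving_upper l k' r r' hl' hk' hlt)
    have hpath := M.connected k' k (hk'.trans hk.symm)
    rw [hk] at hpath
    clear hk
    induction hpath with
    | refl => exact hA l k' hlk hpl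
    | tail _ hab ihab => exact hA _ _ hab.2.2 ihab

/-- The number of arcs on a shortest path from a sending agent. -/
theorem exists_depth (M : SocialModel V S R Θ Z) : ∃ d : V → ℕ,
    (∀ k s, M.sub k = Sum.inl s → d k = 0) ∧
    ∀ k r, M.sub k = Sum.inr r → 0 < d k ∧ ∃ l, 0 < M.A l k ∧ d l < d k := by
  classical
  -- `reach n` collects the ends of walks of exactly `n` arcs that start at a sending agent.
  let reach : ℕ → Set V := fun n => Nat.rec (motive := fun _ => Set V) {k | ∃ s, M.sub k = Sum.inl s}
    (fun _ U => {k | ∃ l, 0 < M.A l k ∧ l ∈ U}) n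
  have hex : ∀ k, ∃ n, k ∈ reach n := fun k =>
    M.mem_of_closed (fun k => ∃ n, k ∈ reach n) (fun k s hk => ⟨0, s, hk⟩)
      (fun l k hlk ⟨n, hn⟩ => ⟨n + 1, l, hlk, hn⟩) k
  let d : V → ℕ := fun k => Nat.find (hex k)
  refine ⟨d, fun k s hk => ?_, fun k r hk => ?_⟩
  · exact (Nat.find_eq_zero (hex k)).2 ⟨s, hk⟩
  · have h0 : d k ≠ 0 := by
      rw [Ne, Nat.find_eq_zero]
      rintro ⟨s, hs⟩
      simp [hk] at hs
    obtain ⟨n, hn⟩ := Nat.exists_eq_succ_of_ne_zero h0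
    have h1 : k ∈ reach (d k) := Nat.find_spec (hex k)
    rw [hn] at h1
    obtain ⟨l, hl, hl'⟩ := h1
    exact ⟨Nat.pos_of_ne_zero h0, l, hl,
      lt_of_le_of_lt (Nat.find_min' (hex l) hl') (hn ▸ Nat.lt_succ_self n)⟩

/-- The combination matrix of the receiving agents contracts a weighted maximum norm. -/
theorem exists_contraction (M : SocialModel V S R Θ Z) : ∃ h : V → ℝ, ∃ ρ : ℝ, 0 ≤ ρ ∧ ρ < 1 ∧
    (∀ k s, M.sub k = Sum.inl s → h k = 0) ∧
    ∀ k r, M.sub k = Sum.inr r → 1 / 2 ≤ h k ∧ ∑ l, M.A l k * h l ≤ ρ * h k := by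
  obtain ⟨a, ha0, ha1, ha⟩ := M.exists_le_A
  obtain ⟨d, hd0, hd⟩ := M.exists_depth
  set η := a / 2 with hη
  have hη0 : 0 < η := by positivity
  have hη1 : η ≤ 1 / 2 := by linarith
  obtain ⟨t, ht0, ht1, ht⟩ := exists_pos_le_of_finite fun k => η ^ d k
  -- A neighbour `l` of smaller depth has `A l k * η ^ d l ≥ 2 * η * η ^ d l ≥ 2 * η ^ d k`, so the
  -- average of the weights is at most `1 - 2 * η ^ d k`. Since `t ≤ η ^ d k`, this is at most `(1 -
  -- t) * (1 - η ^ d k)`.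
  refine ⟨fun k => 1 - η ^ d k, 1 - t, by linarith, by linarith,
    fun k s hk => by simp [hd0 k s hk], fun k r hk => ?_⟩
  obtain ⟨hk0, l, hl, hlk⟩ := hd k r hk
  have htk := ht k (by positivity)
  have hk1 : η ^ d k ≤ η := by
    simpa using pow_le_pow_of_le_one hη0.le (by linarith) hk0
  refine ⟨by linarith, ?_⟩
  have h1 : η ^ d k ≤ η * η ^ d l := by
    rw [← pow_succ']
    exact pow_le_pow_of_le_one hη0.le (by linarith) hlk
  have h2 : M.A l k * η ^ d l ≤ ∑ l, M.A l k * η ^ d l :=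
    Finset.single_le_sum (f := fun l => M.A l k * η ^ d l)
      (fun l _ => mul_nonneg (M.nonneg l k) (by positivity)) (Finset.mem_univ l)
  have h3 : a * η ^ d l ≤ M.A l k * η ^ d l :=
    mul_le_mul_of_nonneg_right (ha l k hl) (by positivity)
  simp_rw [mul_sub, mul_one, Finset.sum_sub_distrib, M.sum_col]
  have h4 : a = 2 * η := by rw [hη]; ring
  rw [h4] at h3
  nlinarith

theorem exists_rpow_mul_lt_one {C ρ : ℝ} (hC : 0 < C) (hρ : ρ < 1) :
    ∃ β : ℝ, 0 < β ∧ β < 1 ∧ C ^ β * ρ < 1 := by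
  have h1 : Tendsto (fun β : ℝ => C ^ β * ρ) (𝓝[>] 0) (𝓝 (C ^ (0 : ℝ) * ρ)) :=
    ((Real.continuous_const_rpow hC.ne').mul continuous_const).continuousAt.tendsto.mono_left
      nhdsWithin_le_nhds
  rw [Real.rpow_zero, one_mul] at h1
  obtain ⟨β, hβ, h0, h1⟩ := ((h1.eventually_lt_const hρ).and
    (Ioo_mem_nhdsGT (zero_lt_one' ℝ))).exists
  exact ⟨β, h0, h1, hβ⟩

theorem pathAdapted_err_rpow (n : ℕ) (k : V) (β : ℝ) :
    PathAdapted n fun x => M.err x n k ^ β :=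
  adapted_belief n fun b => (1 - ∑ θ ∈ M.target k, b k θ) ^ β

/-- Jensen's inequality for the power `1 + β` handles the diffusion. Of the `1 + β` factors of the
Bayes error, `β` are bounded pathwise at cost `(2 / ε) ^ β`; the remaining one is left to be
averaged without loss. -/
theorem err_rpow_succ_le {x : ℕ → (k : V) → Z k} (hx : M.Feasible x) {ε : ℝ} (hε : 0 < ε)
    (hL : ∀ k ζ, 0 < M.trueL k ζ → ε ≤ M.trueL k ζ)
    (hT : ∀ k, ∀ θ ∈ M.target k, ∀ ζ, M.L k θ ζ = M.trueL k ζ)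
    {β : ℝ} (hβ : 0 < β) (i : ℕ) (k : V) :
    M.err x (i + 1) k ^ (1 + β) ≤ ∑ l, M.A l k * ((2 / ε) ^ β * (M.err x i l ^ β *
      (1 - ∑ θ ∈ M.target l, M.bayes l (M.belief x i l) (x (i + 1) l) θ))) := by
  have hψ : ∀ l, 0 ≤ 1 - ∑ θ ∈ M.target l, M.bayes l (M.belief x i l) (x (i + 1) l) θ :=
    fun l => sub_nonneg.2 ((isSubProb_bayes (M.isSubProb_belief x i l) _).sum_le_one _)
  refine (Real.rpow_le_rpow (M.err_nonneg x (i + 1) k) (M.err_succ_le x i k)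
    (by linarith)).trans ?_
  refine (Real.rpow_arith_mean_le_arith_mean_rpow _ _ _ (fun l _ => M.nonneg l k) (M.sum_col k)
    (fun l _ => hψ l) (by linarith)).trans ?_
  refine Finset.sum_le_sum fun l _ => mul_le_mul_of_nonneg_left ?_ (M.nonneg l k)
  rw [add_comm (1 : ℝ), Real.rpow_add' (hψ l) (by linarith), Real.rpow_one, ← mul_assoc,
    ← Real.mul_rpow (by positivity) (M.err_nonneg x i l)]
  refine mul_le_mul_of_nonneg_right (Real.rpow_le_rpow (hψ l) ?_ hβ.le) (hψ l)
  exact one_sub_bayes_le (M.isSubProb_belief x i l) (fun θ hθ => hT l θ hθ _) hε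
    (hL _ _ (hx (i + 1) (by omega) l))

variable [∀ k, MeasurableSpace (Z k)] [∀ k, MeasurableSingletonClass (Z k)]
  {Ω : Type*} [MeasurableSpace Ω] {P : Measure Ω} [IsProbabilityMeasure P]
  {ξ : ℕ → Ω → (k : V) → Z k}

theorem IsSignalSequence.integral_err_rpow_succ_le (hξ : M.IsSignalSequence P ξ) {ε : ℝ}
    (hε : 0 < ε) (hL : ∀ k ζ, 0 < M.trueL k ζ → ε ≤ M.trueL k ζ)
    (hT : ∀ k, ∀ θ ∈ M.target k, ∀ ζ, M.L k θ ζ = M.trueL k ζ)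
    {β : ℝ} (hβ : 0 < β) (i : ℕ) (k : V) :
    ∫ ω, M.err (fun j => ξ j ω) (i + 1) k ^ (1 + β) ∂P ≤
      (2 / ε) ^ β * ∑ l, M.A l k * ∫ ω, M.err (fun j => ξ j ω) i l ^ (1 + β) ∂P := by
  let G : (l : V) → Z l → (ℕ → (k : V) → Z k) → ℝ := fun l ζ x =>
    M.err x i l ^ β * (1 - ∑ θ ∈ M.target l, M.bayes l (M.belief x i l) ζ θ)
  have hG : ∀ l ζ, PathAdapted i (G l ζ) := fun l ζ =>
    adapted_belief i fun b => (1 - ∑ θ ∈ M.target l, b l θ) ^ β *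
      (1 - ∑ θ ∈ M.target l, M.bayes l (b l) ζ θ)
  have hG' : ∀ l, Integrable (fun ω => G l (ξ (i + 1) ω l) fun j => ξ j ω) P := by
    intro l
    refine hξ.integrable (n := i + 1) (F := fun x => G l (x (i + 1) l) x) fun x y hxy => ?_
    beta_reduce
    rw [hxy (i + 1) (by omega) le_rfl]
    exact hG l _ x y fun j h1 h2 => hxy j h1 (by omega)
  have hstep : ∀ l, ∫ ω, G l (ξ (i + 1) ω l) (fun j => ξ j ω) ∂P ≤
      ∫ ω, M.err (fun j => ξ j ω) i l ^ (1 + β) ∂P := by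
    intro l
    rw [hξ.integral_step l (hG l)]
    refine integral_mono
      (integrable_finsetSum _ fun ζ _ => (hξ.integrable (hG l ζ)).const_mul _)
      (hξ.integrable (pathAdapted_err_rpow i l _)) fun ω => ?_
    have h1 := sum_trueL_mul_one_sub_bayes_le (M.isSubProb_belief (fun j => ξ j ω) i l) (hT l)
    have h0 := M.err_nonneg (fun j => ξ j ω) i l
    simp only [G, mul_left_comm (M.trueL _ _), ← Finset.mul_sum]
    rw [add_comm, Real.rpow_add' h0 (by linarith), Real.rpow_one]
    exact mul_le_mul_of_nonneg_left h1 (Real.rpow_nonneg h0 _)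
  have hI : ∀ l, Integrable (fun ω => M.A l k *
      ((2 / ε) ^ β * G l (ξ (i + 1) ω l) fun j => ξ j ω)) P :=
    fun l => ((hG' l).const_mul _).const_mul _
  refine (integral_mono_ae (hξ.integrable (pathAdapted_err_rpow (i + 1) k _))
    (integrable_finsetSum _ fun l _ => hI l)
    (hξ.ae_feasible.mono fun ω hω => err_rpow_succ_le hω hε hL hT hβ i k)).trans ?_
  rw [integral_finsetSum _ fun l _ => hI l, Finset.mul_sum]
  refine Finset.sum_le_sum fun l _ => ?_
  rw [integral_const_mul, integral_const_mul, mul_left_comm]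
  exact mul_le_mul_of_nonneg_left (mul_le_mul_of_nonneg_left (hstep l) (M.nonneg l k))
    (by positivity)

/-- If the lack of belief of the sending agents in their target sets has summable moments of all
orders above one, then the beliefs of all the agents concentrate on their target sets. -/
theorem IsSignalSequence.ae_tendsto_err (hξ : M.IsSignalSequence P ξ)
    (hT : ∀ k, ∀ θ ∈ M.target k, ∀ ζ, M.L k θ ζ = M.trueL k ζ)
    (hsend : ∀ β : ℝ, 0 < β → β < 1 → ∀ k s, M.sub k = Sum.inl s →
      Summable fun i => ∫ ω, M.err (fun j => ξ j ω) i k ^ (1 + β) ∂P) (k : V) :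
    ∀ᵐ ω ∂P, Tendsto (fun i => M.err (fun j => ξ j ω) i k) atTop (𝓝 0) := by
  obtain ⟨ε, hε, -, hL⟩ := M.exists_pos_le_trueL
  obtain ⟨h, ρ, hρ0, hρ1, hs, hr⟩ := M.exists_contraction
  obtain ⟨β, hβ0, hβ1, hβ⟩ := exists_rpow_mul_lt_one (C := 2 / ε) (by positivity) hρ1
  set D := (2 / ε) ^ β with hD
  have hD0 : 0 ≤ D := by positivity
  let e : V → ℕ → ℝ := fun k i => ∫ ω, M.err (fun j => ξ j ω) i k ^ (1 + β) ∂P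
  have he0 : ∀ k i, 0 ≤ e k i := fun k i =>
    integral_nonneg fun ω => Real.rpow_nonneg (M.err_nonneg _ i k) _
  have he1 : ∀ k i, e k i ≤ 1 := by
    intro k i
    have := integral_mono (μ := P) (hξ.integrable (pathAdapted_err_rpow i k (1 + β)))
      (integrable_const (1 : ℝ)) fun ω =>
        Real.rpow_le_one (M.err_nonneg _ i k) (M.err_le_one _ i k) (by linarith)
    simpa using this
  have hstep : ∀ k i, e k (i + 1) ≤ D * ∑ l, M.A l k * e l i := fun k i =>
    hξ.integral_err_rpow_succ_le hε hL hT hβ0 i k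
  obtain ⟨B, hB0, hB⟩ : ∃ B, 0 ≤ B ∧ ∀ k s, M.sub k = Sum.inl s →
      ∀ N, ∑ i ∈ Finset.range N, e k i ≤ B := by
    refine ⟨∑ k, ∑' i, e k i, Finset.sum_nonneg fun k _ => tsum_nonneg (he0 k),
      fun k s hk N => ?_⟩
    exact ((hsend β hβ0 hβ1 k s hk).sum_le_tsum _ fun i _ => he0 k i).trans
      (Finset.single_le_sum (f := fun k => ∑' i, e k i) (fun k _ => tsum_nonneg (he0 k))
        (Finset.mem_univ k))
  have hc : 0 < 1 - D * ρ := by linarith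
  -- Chosen so that `1 + D * (B + K * ρ * h k) ≤ B + K * h k` whenever `h k ≥ 1 / 2`: the bound on
  -- partial sums then passes from `N` to `N + 1`. The 1 bounds the term of time 0.
  set K := 2 * (1 + D * B) / (1 - D * ρ) with hK
  have hK0 : 0 ≤ K := by positivity
  have hKc : K * (1 - D * ρ) = 2 * (1 + D * B) := div_mul_cancel₀ _ hc.ne'
  have hbound : ∀ N k, ∑ i ∈ Finset.range N, e k i ≤ B + K * h k := by
    intro N
    induction N with
    | zero =>
      intro k
      rcases hk : M.sub k with s | r
      · simpa [hs k s hk] using hB0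
      · have := (hr k r hk).1
        simp only [Finset.range_zero, Finset.sum_empty]
        positivity
    | succ N ih =>
      intro k
      rcases hk : M.sub k with s | r
      · simpa [hs k s hk] using hB k s hk (N + 1)
      · obtain ⟨h1, h2⟩ := hr k r hk
        rw [Finset.sum_range_succ']
        have h3 : ∑ i ∈ Finset.range N, e k (i + 1) ≤
            D * ∑ l, M.A l k * ∑ i ∈ Finset.range N, e l i := by
          refine (Finset.sum_le_sum fun i _ => hstep k i).trans_eq ?_
          simp_rw [← Finset.mul_sum]
          rw [Finset.sum_comm]
          simp_rw [← Finset.mul_sum]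
        have h4 : ∑ l, M.A l k * ∑ i ∈ Finset.range N, e l i ≤ B + K * (ρ * h k) := by
          refine (Finset.sum_le_sum fun l _ =>
            mul_le_mul_of_nonneg_left (ih l) (M.nonneg l k)).trans ?_
          simp_rw [mul_add, Finset.sum_add_distrib, ← Finset.sum_mul, M.sum_col, one_mul,
            mul_left_comm _ K, ← Finset.mul_sum]
          gcongr
        have h5 := mul_le_mul_of_nonneg_left h4 hD0
        have h6 := he1 k 0
        have h7 : (1 + D * B) ≤ K * (1 - D * ρ) * h k := by
          rw [hKc]
          nlinarith [mul_nonneg hD0 hB0]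
        nlinarith
  have hsum : Summable (e k) :=
    summable_of_sum_range_le (he0 k) fun N => hbound N k
  have hlim := ae_tendsto_zero_of_summable_integral
    (fun i ω => Real.rpow_nonneg (M.err_nonneg (fun j => ξ j ω) i k) (1 + β))
    (fun i => hξ.integrable (pathAdapted_err_rpow i k (1 + β))) hsum
  filter_upwards [hlim] with ω hω
  have h1 := hω.rpow_const (p := (1 + β)⁻¹) (Or.inr (by positivity))
  rw [Real.zero_rpow (by positivity)] at h1
  refine h1.congr fun i => ?_
  rw [← Real.rpow_mul (M.err_nonneg _ i k), mul_inv_cancel₀ (by linarith), Real.rpow_one]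

end SocialModel

/-! ### Sending sub-networks: Perron vector, positivity and spreading of beliefs. -/

namespace SocialModel

variable {V : Type*} [Fintype V] {S R : ℕ} {Θ : Type*} [Fintype Θ]
  {Z : V → Type*} [∀ k, Fintype (Z k)] {M : SocialModel V S R Θ Z}

/-- A Perron vector of the `s`-th sending sub-network. -/
structure IsPerron (M : SocialModel V S R Θ Z) (s : Fin S) (p : V → ℝ) : Prop where
  nonneg : ∀ k, 0 ≤ p k
  pos : ∀ k, M.sub k = Sum.inl s → 0 < p k
  eq_zero : ∀ k, M.sub k ≠ Sum.inl s → p k = 0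
  sum_mul : ∀ l, ∑ k, M.A l k * p k = p l

theorem connected_sending (M : SocialModel V S R Θ Z) {s : Fin S} {l k : V}
    (hl : M.sub l = Sum.inl s) (hk : M.sub k = Sum.inl s) : Relation.ReflTransGen
      (fun i j => M.sub i = Sum.inl s ∧ M.sub j = Sum.inl s ∧ 0 < M.A i j) l k := by
  simpa [hk] using M.connected l k (hl.trans hk.symm)

theorem sub_eq_of_A_pos {s : Fin S} {l k : V} (hk : M.sub k = Sum.inl s) (h : 0 < M.A l k) :
    M.sub l = Sum.inl s :=
  by_contra fun hl => h.ne' (M.sending_closed l k s hk hl)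

theorem exists_isPerron (M : SocialModel V S R Θ Z) (s : Fin S) : ∃ p, M.IsPerron s p := by
  classical
  obtain ⟨k₀, hk₀, -⟩ := M.self_loop s
  -- Sending all outside columns to `k₀` keeps `B` column-stochastic and makes its rows outside the
  -- sub-network vanish, so every fixed vector is supported in the sub-network.
  let B : Matrix V V ℝ := fun l k =>
    if M.sub k = Sum.inl s then M.A l k else if l = k₀ then 1 else 0
  have hB0 : ∀ l k, 0 ≤ B l k := by
    intro l k
    simp only [B]
    split_ifs <;> simp [M.nonneg]
  have hB1 : ∀ k, ∑ l, B l k = 1 := by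
    intro k
    by_cases hk : M.sub k = Sum.inl s
    · simp [B, hk, M.sum_col]
    · simp [B, hk]
  have hdet : (B - 1).det = 0 := by
    refine Matrix.exists_vecMul_eq_zero_iff.1 ⟨fun _ => 1, fun h => ?_, ?_⟩
    · exact one_ne_zero (congrFun h k₀)
    · ext k
      simp [Matrix.vecMul, dotProduct, Matrix.sub_apply, Finset.sum_sub_distrib, hB1,
        Matrix.one_apply]
  obtain ⟨v, hv, hv'⟩ := Matrix.exists_mulVec_eq_zero_iff.2 hdet
  have hv1 : ∀ l, ∑ k, B l k * v k = v l := by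
    intro l
    rw [Matrix.sub_mulVec, Matrix.one_mulVec, sub_eq_zero] at hv'
    exact congrFun hv' l
  let p : V → ℝ := fun k => |v k|
  have hle : ∀ l, p l ≤ ∑ k, B l k * p k := by
    intro l
    simp only [p]
    rw [← hv1 l]
    refine (Finset.abs_sum_le_sum_abs _ _).trans_eq (Finset.sum_congr rfl fun k _ => ?_)
    rw [abs_mul, abs_of_nonneg (hB0 l k)]
  have heq : ∀ l, ∑ k, B l k * p k = p l := by
    -- Column sums equal to one make both sides of `hle` have the same total, so every inequality is
    -- an equality.
    have h1 : ∑ l, p l = ∑ l, ∑ k, B l k * p k := by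
      rw [Finset.sum_comm]
      simp_rw [← Finset.sum_mul, hB1, one_mul]
    intro l
    exact ((Finset.sum_eq_sum_iff_of_le fun l _ => hle l).1 h1 l (Finset.mem_univ l)).symm
  have hzero : ∀ l, M.sub l ≠ Sum.inl s → p l = 0 := by
    intro l hl
    rw [← heq l]
    refine Finset.sum_eq_zero fun k _ => ?_
    by_cases hk : M.sub k = Sum.inl s
    · simp [B, hk, M.sending_closed l k s hk hl]
    · have : l ≠ k₀ := fun h => hl (h ▸ hk₀)
      simp [B, hk, this]
  have hsum : ∀ l, ∑ k, M.A l k * p k = p l := by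
    intro l
    rw [← heq l]
    refine Finset.sum_congr rfl fun k _ => ?_
    by_cases hk : M.sub k = Sum.inl s
    · simp [B, hk]
    · simp [hzero k hk]
  refine ⟨p, fun k => abs_nonneg _, fun l hl => ?_, hzero, hsum⟩
  obtain ⟨k, hk⟩ := Function.ne_iff.1 hv
  have hpk : 0 < p k := abs_pos.2 hk
  have hks : M.sub k = Sum.inl s := by_contra fun h => hpk.ne' (hzero k h)
  have hpath := M.connected_sending hl hks
  induction hpath using Relation.ReflTransGen.head_induction_on with
  | refl => exact hpk
  | @head a b hab _ ih =>
    rw [← hsum a]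
    exact (mul_pos hab.2.2 (ih hab.2.1)).trans_le (Finset.single_le_sum
      (f := fun k => M.A a k * p k) (fun k _ => mul_nonneg (M.nonneg _ _) (abs_nonneg _))
      (Finset.mem_univ b))

theorem evidence_pos {k : V} {μ : Θ → ℝ} (h : IsSubProb μ) {θ : Θ} {ζ : Z k} (hμ : 0 < μ θ)
    (hL : 0 < M.L k θ ζ) : 0 < M.evidence k μ ζ :=
  (mul_pos hμ hL).trans_le (mul_L_le_evidence h θ ζ)

theorem mul_L_le_bayes {k : V} {μ : Θ → ℝ} (h : IsSubProb μ) (θ : Θ) (ζ : Z k) :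
    μ θ * M.L k θ ζ ≤ M.bayes k μ ζ θ := by
  rw [bayes_eq]
  rcases (evidence_nonneg (M := M) h ζ).eq_or_lt with h0 | h0
  · rw [← h0, div_zero, h0]
    exact mul_L_le_evidence h θ ζ
  · rw [le_div_iff₀ h0]
    exact mul_le_of_le_one_right (mul_nonneg (h.1 θ) (M.L_nonneg k θ ζ)) (evidence_le_one h ζ)

theorem mul_belief_le_belief_succ (x : ℕ → (k : V) → Z k) (i : ℕ) (l k : V) (θ : Θ) :
    M.A l k * (M.belief x i l θ * M.L l θ (x (i + 1) l)) ≤ M.belief x (i + 1) k θ := by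
  rw [belief_succ]
  exact (mul_le_mul_of_nonneg_left (mul_L_le_bayes (M.isSubProb_belief x i l) θ _)
    (M.nonneg l k)).trans (Finset.single_le_sum
      (f := fun l => M.A l k * M.bayes l (M.belief x i l) (x (i + 1) l) θ)
      (fun l _ => mul_nonneg (M.nonneg l k) (bayes_nonneg (M.isSubProb_belief x i l) _ θ))
      (Finset.mem_univ l))

theorem L_truth_eq {s : Fin S} {k : V} (hk : M.sub k = Sum.inl s) (ζ : Z k) :
    M.L k (M.truth (Sum.inl s)) ζ = M.trueL k ζ := by
  rw [trueL, hk]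

theorem belief_succ_pos {x : ℕ → (k : V) → Z k} (hx : M.Feasible x) {s : Fin S} {i : ℕ} {l k : V}
    (hl : M.sub l = Sum.inl s) (hA : 0 < M.A l k)
    (h : 0 < M.belief x i l (M.truth (Sum.inl s))) :
    0 < M.belief x (i + 1) k (M.truth (Sum.inl s)) := by
  refine lt_of_lt_of_le ?_ (M.mul_belief_le_belief_succ x i l k _)
  rw [L_truth_eq hl]
  exact mul_pos hA (mul_pos h (hx (i + 1) (by omega) l))

/-- From some time on, all the agents of a sending sub-network have a positive belief in the
true state. -/
theorem eventually_belief_pos {s : Fin S}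
    (hprior : ∃ k, M.sub k = Sum.inl s ∧ 0 < M.prior k (M.truth (Sum.inl s))) :
    ∀ᶠ i in atTop, ∀ k, M.sub k = Sum.inl s → ∀ x, M.Feasible x →
      0 < M.belief x i k (M.truth (Sum.inl s)) := by
  obtain ⟨k₁, hk₁, hpos⟩ := hprior
  obtain ⟨k₀, hk₀, hloop⟩ := M.self_loop s
  have h1 : ∃ n, ∀ x, M.Feasible x → 0 < M.belief x n k₀ (M.truth (Sum.inl s)) := by
    have hpath := M.connected_sending hk₁ hk₀
    clear hloop hk₀
    induction hpath with
    | refl => exact ⟨0, fun x _ => hpos⟩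
    | tail _ hab ih =>
      obtain ⟨n, hn⟩ := ih
      exact ⟨n + 1, fun x hx => belief_succ_pos hx hab.1 hab.2.2 (hn x hx)⟩
  obtain ⟨n, hn⟩ := h1
  -- The self-loop at `k₀` preserves positivity forever, so that it reaches every agent at all late
  -- times and not only at times of a suitable residue.
  have h2 : ∀ i, n ≤ i → ∀ x, M.Feasible x → 0 < M.belief x i k₀ (M.truth (Sum.inl s)) := by
    intro i hi
    induction i, hi using Nat.le_induction with
    | base => exact hn
    | succ i _ ih => exact fun x hx => belief_succ_pos hx hk₀ hloop (ih x hx)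
  refine eventually_all.2 fun k => ?_
  by_cases hk : M.sub k = Sum.inl s
  swap
  · simp [hk]
  have hpath := M.connected_sending hk₀ hk
  suffices ∃ m, ∀ i, m ≤ i → ∀ x, M.Feasible x → 0 < M.belief x i k (M.truth (Sum.inl s)) by
    obtain ⟨m, hm⟩ := this
    exact eventually_atTop.2 ⟨m, fun i hi _ => hm i hi⟩
  clear hk
  induction hpath with
  | refl => exact ⟨n, h2⟩
  | tail _ hab ih =>
    obtain ⟨m, hm⟩ := ih
    refine ⟨m + 1, fun i hi x hx => ?_⟩
    obtain ⟨j, rfl⟩ := Nat.exists_eq_succ_of_ne_zero (show i ≠ 0 by omega)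
    exact belief_succ_pos hx hab.1 hab.2.2 (hm j (by omega) x hx)

open Classical in
/-- The mass of the states that agent `k` distinguishes from the true state. -/
noncomputable def distMass (M : SocialModel V S R Θ Z) (k : V) (μ : Θ → ℝ) : ℝ :=
  ∑ θ with θ ∉ M.indist k, μ θ

theorem distMass_nonneg {k : V} {μ : Θ → ℝ} (h : IsSubProb μ) : 0 ≤ M.distMass k μ :=
  h.sum_nonneg _

theorem le_distMass {k : V} {μ : Θ → ℝ} (h : IsSubProb μ) {θ : Θ} (hθ : θ ∉ M.indist k) :
    μ θ ≤ M.distMass k μ := by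
  classical
  exact Finset.single_le_sum (fun θ _ => h.1 θ) (by simpa using hθ)

theorem distMass_le_one_sub {k : V} {μ : Θ → ℝ} (h : IsSubProb μ) {θ : Θ}
    (hθ : θ ∈ M.indist k) : M.distMass k μ ≤ 1 - μ θ := by
  classical
  have h1 := h.sum_le_one (Finset.cons θ (Finset.univ.filter fun θ => θ ∉ M.indist k)
    (by simpa using hθ))
  rw [Finset.sum_cons] at h1
  unfold distMass
  linarith

/-- A state that is not the true one moves, along a path of positive weights, to an agent that
distinguishes it from the true one. -/
theorem exists_belief_le_distMass {s : Fin S}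
    (hident : (⋂ k ∈ {k | M.sub k = Sum.inl s}, M.indist k) = {M.truth (Sum.inl s)})
    {k : V} (hk : M.sub k = Sum.inl s) {θ : Θ} (hθ : θ ≠ M.truth (Sum.inl s)) :
    ∃ n l c, M.sub l = Sum.inl s ∧ 0 < c ∧ ∀ x, M.Feasible x → ∀ i,
      c * M.belief x i k θ ≤ M.distMass l (M.belief x (i + n) l) := by
  obtain ⟨ε, hε, -, hL⟩ := M.exists_pos_le_trueL
  obtain ⟨m, hm, hmθ⟩ : ∃ m, M.sub m = Sum.inl s ∧ θ ∉ M.indist m := by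
    by_contra! h
    have : θ ∈ ⋂ k ∈ {k | M.sub k = Sum.inl s}, M.indist k := by simpa using h
    rw [hident] at this
    exact hθ this
  have hbase : ∀ k, M.sub k = Sum.inl s → θ ∉ M.indist k →
      ∃ n l c, M.sub l = Sum.inl s ∧ 0 < c ∧ ∀ x, M.Feasible x → ∀ i,
        c * M.belief x i k θ ≤ M.distMass l (M.belief x (i + n) l) := fun k hk hkθ =>
    ⟨0, k, 1, hk, one_pos, fun x _ i => by
      simpa using le_distMass (M.isSubProb_belief x i k) hkθ⟩
  have hpath := M.connected_sending hk hm
  clear hk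
  induction hpath using Relation.ReflTransGen.head_induction_on with
  | refl => exact hbase m hm hmθ
  | @head a b hab _ ih =>
    obtain ⟨n, l, c, hl, hc, h⟩ := ih
    -- While the agent holding `θ` cannot distinguish it, its likelihood equals the true one, hence
    -- is at least `ε`, and a fixed fraction of the mass passes to the next agent. The path stops at
    -- the first agent that distinguishes `θ`.
    by_cases ha : θ ∈ M.indist a
    swap
    · exact hbase a hab.1 ha
    refine ⟨n + 1, l, c * (M.A a b * ε), hl, mul_pos hc (mul_pos hab.2.2 hε),
      fun x hx i => ?_⟩
    have h1 := h x hx (i + 1)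
    rw [add_right_comm, add_assoc] at h1
    refine le_trans ?_ h1
    rw [mul_assoc]
    refine mul_le_mul_of_nonneg_left ?_ hc.le
    refine le_trans ?_ (M.mul_belief_le_belief_succ x i a b θ)
    rw [mul_assoc, mul_comm ε]
    refine mul_le_mul_of_nonneg_left (mul_le_mul_of_nonneg_left ?_
      ((M.isSubProb_belief x i a).1 θ)) hab.2.2.le
    rw [ha]
    exact hL a _ (hx (i + 1) (by omega) a)

end SocialModel

/-! ### The potential and its decrease. -/

/-- The gap between the means is `(√a - √b) ^ 2 / 2`, and `(a - b) ^ 2 ≤ 4 * (√a - √b) ^ 2` because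
`√a + √b ≤ 2`. -/
theorem sqrt_mul_le_sub_sq {a b : ℝ} (ha : 0 ≤ a) (ha' : a ≤ 1) (hb : 0 ≤ b) (hb' : b ≤ 1) :
    √(a * b) ≤ (a + b) / 2 - (a - b) ^ 2 / 8 := by
  rw [Real.sqrt_mul ha]
  have h1 := Real.sq_sqrt ha
  have h2 := Real.sq_sqrt hb
  have h3 : √a ≤ 1 := Real.sqrt_le_one.2 ha'
  have h4 : √b ≤ 1 := Real.sqrt_le_one.2 hb'
  have h5 := Real.sqrt_nonneg a
  have h6 := Real.sqrt_nonneg b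
  set u := √a
  set v := √b
  rw [← h1, ← h2]
  have h7 : (u + v) ^ 2 ≤ 4 := by nlinarith
  nlinarith [mul_le_mul_of_nonneg_left h7 (sq_nonneg (u - v))]

theorem inv_sqrt_ge_tangent {s t : ℝ} (hs : 0 < s) (ht : 0 < t) :
    (√s)⁻¹ * (3 / 2 - t / (2 * s)) ≤ (√t)⁻¹ := by
  have h1 := Real.sq_sqrt hs.le
  have h2 := Real.sq_sqrt ht.le
  have hu := Real.sqrt_pos.2 hs
  have hv := Real.sqrt_pos.2 ht
  set u := √s
  set v := √t
  rw [← h1, ← h2, ← sub_nonneg]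
  have : v⁻¹ - u⁻¹ * (3 / 2 - v ^ 2 / (2 * u ^ 2)) =
      (v - u) ^ 2 * (v + 2 * u) / (2 * u ^ 3 * v) := by
    field_simp
    ring
  rw [this]
  positivity

/-- Jensen's inequality, from the tangent at the mean. Positivity is required only where the weight
is positive, since agents outside the sub-network may have zero belief in its true state. -/
theorem inv_sqrt_sum_le {ι : Type*} [Fintype ι] {w z : ι → ℝ} (hw : ∀ i, 0 ≤ w i)
    (hw1 : ∑ i, w i = 1) (hz : ∀ i, 0 < w i → 0 < z i) :
    (√(∑ i, w i * z i))⁻¹ ≤ ∑ i, w i * (√(z i))⁻¹ := by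
  have hz0 : ∀ i, 0 ≤ w i * z i := fun i => by
    rcases (hw i).eq_or_lt with h | h
    · simp [← h]
    · exact (mul_pos h (hz i h)).le
  obtain ⟨i₀, hi₀⟩ : ∃ i, 0 < w i := by
    by_contra! h
    have := Finset.sum_nonpos fun i (_ : i ∈ Finset.univ) => h i
    linarith
  have hs : 0 < ∑ i, w i * z i := (mul_pos hi₀ (hz i₀ hi₀)).trans_le
    (Finset.single_le_sum (f := fun i => w i * z i) (fun i _ => hz0 i) (Finset.mem_univ i₀))
  set s := ∑ i, w i * z i with hsdef
  have h1 : ∀ i, w i * ((√s)⁻¹ * (3 / 2)) - w i * z i * ((√s)⁻¹ / (2 * s)) ≤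
      w i * (√(z i))⁻¹ := by
    intro i
    rcases (hw i).eq_or_lt with h | h
    · simp [← h]
    · have := mul_le_mul_of_nonneg_left (inv_sqrt_ge_tangent hs (hz i h)) h.le
      refine le_trans (le_of_eq ?_) this
      ring
  have h2 := Finset.sum_le_sum fun i (_ : i ∈ Finset.univ) => h1 i
  rw [Finset.sum_sub_distrib, ← Finset.sum_mul, ← Finset.sum_mul, hw1, ← hsdef] at h2
  refine le_trans (le_of_eq ?_) h2
  field_simp
  ring

/-- The tangent of the concave function `t + t ^ β` lies above it; at `0`, where the slope is
infinite, there is nothing to prove when `t'` is `0`. -/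
theorem add_rpow_le_tangent {β t t' u : ℝ} (hβ0 : 0 < β) (hβ1 : β < 1) (ht : 0 ≤ t)
    (ht' : 0 ≤ t') (hu : t' ≤ u) (h0 : t = 0 → u ≤ 0) :
    t' + t' ^ β ≤ t + t ^ β + (1 + β * t ^ (β - 1)) * (u - t) := by
  rcases ht.eq_or_lt with h | h
  · have hu0 := h0 h.symm
    have h1 : t' = 0 := by linarith
    have h2 : u = 0 := by linarith
    rw [← h, h1, h2]
    simp
  · have h1 : t' ^ β ≤ u ^ β := Real.rpow_le_rpow ht' hu hβ0.le
    have hu0 : 0 ≤ u := ht'.trans hu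
    have h2 := rpow_one_add_le_one_add_mul_self (s := u / t - 1)
      (by have := div_nonneg hu0 ht; linarith) hβ0.le hβ1.le
    rw [add_sub_cancel, Real.div_rpow hu0 ht, div_le_iff₀ (Real.rpow_pos_of_pos h β)] at h2
    have h3 : t ^ (β - 1) * t = t ^ β := by
      rw [← Real.rpow_add_one h.ne', sub_add_cancel]
    have h4 : (1 + β * (u / t - 1)) * t ^ β = t ^ β + β * t ^ (β - 1) * (u - t) := by
      rw [← h3]
      field_simp
    nlinarith

namespace SocialModel

variable {V : Type*} [Fintype V] {S R : ℕ} {Θ : Type*} [Fintype Θ]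
  {Z : V → Type*} [∀ k, Fintype (Z k)] {M : SocialModel V S R Θ Z} {s : Fin S} {p : V → ℝ}

theorem IsPrevailing.exists_gap {k : V} {ζ : Z k} (h : M.IsPrevailing k ζ) :
    ∃ δ, 0 < δ ∧ ∀ θ ∉ M.indist k, δ ≤ M.trueL k ζ - M.L k θ ζ := by
  obtain ⟨δ, h0, -, hδ⟩ := exists_pos_le_of_finite fun θ => M.trueL k ζ - M.L k θ ζ
  exact ⟨δ, h0, fun θ hθ => hδ θ (sub_pos.2 (h θ hθ))⟩

/-- Each distinguishable state lowers the evidence at `ζ` by at least `δ` per unit of mass, the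
others not at all, and missing mass only lowers it further. -/
theorem mul_distMass_le {k : V} {ζ : Z k} {δ : ℝ}
    (hδ : ∀ θ ∉ M.indist k, δ ≤ M.trueL k ζ - M.L k θ ζ) {μ : Θ → ℝ} (h : IsSubProb μ) :
    δ * M.distMass k μ ≤ M.trueL k ζ - M.evidence k μ ζ := by
  classical
  have h1 : ∑ θ, μ θ * (if θ ∉ M.indist k then δ else 0) ≤
      ∑ θ, μ θ * (M.trueL k ζ - M.L k θ ζ) := by
    refine Finset.sum_le_sum fun θ _ => mul_le_mul_of_nonneg_left ?_ (h.1 θ)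
    split_ifs with hθ
    · exact (sub_eq_zero.2 (hθ ζ).symm).ge
    · exact hδ θ hθ
  have h2 : ∑ θ, μ θ * (if θ ∉ M.indist k then δ else 0) = δ * M.distMass k μ := by
    simp only [distMass, mul_ite, mul_zero]
    rw [← Finset.sum_filter, Finset.mul_sum]
    exact Finset.sum_congr rfl fun θ _ => mul_comm _ _
  have h3 : ∑ θ, μ θ * (M.trueL k ζ - M.L k θ ζ) ≤ M.trueL k ζ - M.evidence k μ ζ := by
    simp_rw [mul_sub, Finset.sum_sub_distrib, ← Finset.sum_mul]
    exact sub_le_sub_right (mul_le_of_le_one_left (M.trueL_nonneg k ζ) h.2) _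
  linarith

theorem bayes_truth_pos {k : V} (hk : M.sub k = Sum.inl s) {μ : Θ → ℝ} (h : IsSubProb μ)
    (hμ : 0 < μ (M.truth (Sum.inl s))) {ζ : Z k} (hζ : 0 < M.trueL k ζ) :
    0 < M.bayes k μ ζ (M.truth (Sum.inl s)) := by
  have hL := (L_truth_eq hk ζ).symm ▸ hζ
  exact div_pos (mul_pos hμ hL) (evidence_pos h hμ hL)

/-- In the mean, Bayes' rule decreases the inverse square root of the belief in the true state,
the more so the more mass there is on the states that can be distinguished from it. -/
theorem sum_trueL_mul_inv_sqrt_bayes_le {k : V} (hk : M.sub k = Sum.inl s) {ζ : Z k} {δ : ℝ}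
    (hδ0 : 0 ≤ δ) (hδ : ∀ θ ∉ M.indist k, δ ≤ M.trueL k ζ - M.L k θ ζ) {μ : Θ → ℝ}
    (h : IsSubProb μ) (hμ : 0 < μ (M.truth (Sum.inl s))) :
    ∑ ζ, M.trueL k ζ * (√(M.bayes k μ ζ (M.truth (Sum.inl s))))⁻¹ ≤
      (√(μ (M.truth (Sum.inl s))))⁻¹ - δ ^ 2 / 8 * M.distMass k μ ^ 2 := by
  set θ₀ := M.truth (Sum.inl s)
  have h1 : ∀ ζ, M.trueL k ζ * (√(M.bayes k μ ζ θ₀))⁻¹ =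
      (√(μ θ₀))⁻¹ * √(M.trueL k ζ * M.evidence k μ ζ) := by
    intro ζ
    rw [bayes_eq, L_truth_eq hk]
    rcases (M.trueL_nonneg k ζ).eq_or_lt with h0 | h0
    · simp [← h0]
    · have hm : 0 < M.evidence k μ ζ := evidence_pos h hμ ((L_truth_eq hk ζ).symm ▸ h0)
      rw [Real.sqrt_div (mul_pos hμ h0).le, Real.sqrt_mul hμ.le, Real.sqrt_mul h0.le]
      have e := Real.mul_self_sqrt h0.le
      have p1 := Real.sqrt_pos.2 h0
      have p2 := Real.sqrt_pos.2 hm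
      have p3 := Real.sqrt_pos.2 hμ
      conv_lhs => rw [← e]
      field_simp
      rw [Real.sqrt_sq p1.le]
  -- The Hellinger affinity of the true law and the predicted law; of the squared differences only
  -- the one at `ζ` is kept.
  have h2 : ∑ ζ', √(M.trueL k ζ' * M.evidence k μ ζ') ≤
      1 - (M.trueL k ζ - M.evidence k μ ζ) ^ 2 / 8 := by
    have h3 := Finset.sum_le_sum fun ζ' (_ : ζ' ∈ Finset.univ) =>
      sqrt_mul_le_sub_sq (M.trueL_nonneg k ζ') (M.trueL_le_one k ζ')
        (evidence_nonneg (M := M) h ζ') (evidence_le_one h ζ')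
    have h4 := Finset.single_le_sum
      (f := fun ζ' => (M.trueL k ζ' - M.evidence k μ ζ') ^ 2 / 8)
      (fun _ _ => by positivity) (Finset.mem_univ ζ)
    rw [Finset.sum_sub_distrib, ← Finset.sum_div, Finset.sum_add_distrib, sum_trueL] at h3
    have h5 := sum_evidence_le_one (M := M) (k := k) h
    linarith
  simp_rw [h1, ← Finset.mul_sum]
  -- The prefactor is at least 1, so it can be dropped from the subtracted square.
  have h3 : 1 ≤ (√(μ θ₀))⁻¹ :=
    (one_le_inv₀ (Real.sqrt_pos.2 hμ)).2 (Real.sqrt_le_one.2 (h.le_one _))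
  have h4 := mul_distMass_le hδ h
  have h5 : (δ * M.distMass k μ) ^ 2 ≤ (M.trueL k ζ - M.evidence k μ ζ) ^ 2 :=
    pow_le_pow_left₀ (mul_nonneg hδ0 (distMass_nonneg h)) h4 2
  have h6 := mul_le_mul_of_nonneg_left h2 (zero_le_one.trans h3)
  nlinarith [sq_nonneg (M.trueL k ζ - M.evidence k μ ζ)]

/-- A weighted excess of the inverse square roots of the beliefs in the true state of a sending
sub-network. -/
noncomputable def potential (M : SocialModel V S R Θ Z) (s : Fin S) (p : V → ℝ)
    (b : V → Θ → ℝ) : ℝ :=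
  ∑ k, p k * ((√(b k (M.truth (Sum.inl s))))⁻¹ - 1)

/-- The expected decrease of a concave function of the potential, up to a constant factor. -/
noncomputable def drop (M : SocialModel V S R Θ Z) (s : Fin S) (p : V → ℝ) (β : ℝ)
    (b : V → Θ → ℝ) : ℝ :=
  (1 + β * M.potential s p b ^ (β - 1)) * ∑ l, p l * M.distMass l (b l) ^ 2

theorem inv_sqrt_sub_one_nonneg {t : ℝ} (h0 : 0 < t) (h1 : t ≤ 1) : 0 ≤ (√t)⁻¹ - 1 :=
  sub_nonneg.2 ((one_le_inv₀ (Real.sqrt_pos.2 h0)).2 (Real.sqrt_le_one.2 h1))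

theorem IsPerron.term_nonneg (hp : M.IsPerron s p) {b : V → Θ → ℝ} (hb : ∀ k, IsSubProb (b k))
    (hpos : ∀ k, M.sub k = Sum.inl s → 0 < b k (M.truth (Sum.inl s))) (k : V) :
    0 ≤ p k * ((√(b k (M.truth (Sum.inl s))))⁻¹ - 1) := by
  by_cases hk : M.sub k = Sum.inl s
  · exact mul_nonneg (hp.nonneg k) (inv_sqrt_sub_one_nonneg (hpos k hk) ((hb k).le_one _))
  · simp [hp.eq_zero k hk]

theorem IsPerron.potential_nonneg (hp : M.IsPerron s p) {b : V → Θ → ℝ}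
    (hb : ∀ k, IsSubProb (b k))
    (hpos : ∀ k, M.sub k = Sum.inl s → 0 < b k (M.truth (Sum.inl s))) :
    0 ≤ M.potential s p b :=
  Finset.sum_nonneg fun k _ => hp.term_nonneg hb hpos k

theorem IsPerron.eq_one_of_potential_eq_zero (hp : M.IsPerron s p) {b : V → Θ → ℝ}
    (hb : ∀ k, IsSubProb (b k))
    (hpos : ∀ k, M.sub k = Sum.inl s → 0 < b k (M.truth (Sum.inl s)))
    (h : M.potential s p b = 0) {k : V} (hk : M.sub k = Sum.inl s) :
    b k (M.truth (Sum.inl s)) = 1 := by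
  have h1 := (Finset.sum_eq_zero_iff_of_nonneg fun k _ => hp.term_nonneg hb hpos k).1 h k
    (Finset.mem_univ k)
  rcases mul_eq_zero.1 h1 with h2 | h2
  · exact absurd h2 (hp.pos k hk).ne'
  · rw [sub_eq_zero, inv_eq_one, Real.sqrt_eq_one] at h2
    exact h2

theorem IsPerron.sum_mul_sum (hp : M.IsPerron s p) (f : V → ℝ) :
    ∑ k, p k * ∑ l, M.A l k * f l = ∑ l, p l * f l := by
  simp_rw [Finset.mul_sum]
  rw [Finset.sum_comm]
  refine Finset.sum_congr rfl fun l _ => ?_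
  rw [← hp.sum_mul l, Finset.sum_mul]
  exact Finset.sum_congr rfl fun k _ => by ring

/-- Diffusion does not increase the potential. -/
theorem IsPerron.potential_succ_le (hp : M.IsPerron s p) {x : ℕ → (k : V) → Z k}
    (hx : M.Feasible x) {i : ℕ}
    (hpos : ∀ k, M.sub k = Sum.inl s → 0 < M.belief x i k (M.truth (Sum.inl s))) :
    M.potential s p (M.belief x (i + 1)) ≤ ∑ l, p l *
      ((√(M.bayes l (M.belief x i l) (x (i + 1) l) (M.truth (Sum.inl s))))⁻¹ - 1) := by
  rw [← hp.sum_mul_sum]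
  refine Finset.sum_le_sum fun k _ => ?_
  by_cases hk : M.sub k = Sum.inl s
  · refine mul_le_mul_of_nonneg_left ?_ (hp.nonneg k)
    simp_rw [mul_sub, mul_one, Finset.sum_sub_distrib, M.sum_col]
    refine sub_le_sub_right ?_ _
    rw [belief_succ]
    refine inv_sqrt_sum_le (fun l => M.nonneg l k) (M.sum_col k) fun l hl => ?_
    have hl' := sub_eq_of_A_pos hk hl
    exact bayes_truth_pos hl' (M.isSubProb_belief x i l) (hpos l hl') (hx (i + 1) (by omega) l)
  · simp [hp.eq_zero k hk]

theorem IsPerron.concave_potential_succ_le (hp : M.IsPerron s p) {x : ℕ → (k : V) → Z k}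
    (hx : M.Feasible x) {β : ℝ} (hβ0 : 0 < β) (hβ1 : β < 1) {i : ℕ}
    (hpos : ∀ k, M.sub k = Sum.inl s → 0 < M.belief x i k (M.truth (Sum.inl s)))
    (hpos' : ∀ k, M.sub k = Sum.inl s → 0 < M.belief x (i + 1) k (M.truth (Sum.inl s))) :
    M.potential s p (M.belief x (i + 1)) + M.potential s p (M.belief x (i + 1)) ^ β ≤
      M.potential s p (M.belief x i) + M.potential s p (M.belief x i) ^ β +
      (1 + β * M.potential s p (M.belief x i) ^ (β - 1)) * (∑ l, p l *
        ((√(M.bayes l (M.belief x i l) (x (i + 1) l) (M.truth (Sum.inl s))))⁻¹ - 1) -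
        M.potential s p (M.belief x i)) := by
  refine add_rpow_le_tangent hβ0 hβ1 (hp.potential_nonneg (M.isSubProb_belief x i) hpos)
    (hp.potential_nonneg (M.isSubProb_belief x (i + 1)) hpos') (hp.potential_succ_le hx hpos)
    fun h0 => (Finset.sum_eq_zero fun l _ => ?_).le
  by_cases hl : M.sub l = Sum.inl s
  · have h1 := hp.eq_one_of_potential_eq_zero (M.isSubProb_belief x i) hpos h0 hl
    have hT : ∀ θ ∈ ({M.truth (Sum.inl s)} : Finset Θ), M.L l θ (x (i + 1) l) =
        M.trueL l (x (i + 1) l) := by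
      simpa using L_truth_eq hl _
    -- Any positive lower bound would do, as the error it multiplies is 0.
    have h2 := one_sub_bayes_le (M.isSubProb_belief x i l) hT (hx (i + 1) (by omega) l) le_rfl
    simp only [Finset.sum_singleton, h1, sub_self, mul_zero] at h2
    have h3 := (isSubProb_bayes (M := M) (M.isSubProb_belief x i l) (x (i + 1) l)).le_one
      (M.truth (Sum.inl s))
    rw [le_antisymm h3 (by linarith)]
    simp
  · simp [hp.eq_zero l hl]

theorem drop_nonneg (hp : M.IsPerron s p) {β : ℝ} (hβ0 : 0 < β) {b : V → Θ → ℝ}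
    (hb : ∀ k, IsSubProb (b k))
    (hpos : ∀ k, M.sub k = Sum.inl s → 0 < b k (M.truth (Sum.inl s))) :
    0 ≤ M.drop s p β b :=
  mul_nonneg (by have := Real.rpow_nonneg (hp.potential_nonneg hb hpos) (β - 1); positivity)
    (Finset.sum_nonneg fun l _ => mul_nonneg (hp.nonneg l) (sq_nonneg _))

end SocialModel

/-! ### Control of the error by later decreases of the potential. -/

/-- To be used with `w` the error now, and `w'`, `t` the error and the potential `n` steps later.
The exponent is negative, so lower bounds on `w` are needed: `t / (2 * Q)` in the first case, `η /
Q` in the second, where the summand 1 of the slope suffices. -/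
theorem rpow_sub_one_le_mul {β w w' t Q η : ℝ} (hβ0 : 0 < β) (hβ1 : β < 1)
    (ht : 0 < t) (hQ : 0 < Q) (hη : 0 < η) (hw' : w' ≤ Q * w) (h : t ≤ 2 * w' ∨ η ≤ w') :
    w ^ (β - 1) ≤
      (((2 * Q) ^ (β - 1))⁻¹ / β + (η / Q) ^ (β - 1)) * (1 + β * t ^ (β - 1)) := by
  have p1 : 0 < (2 * Q) ^ (β - 1) := by positivity
  have p2 : 0 < (η / Q) ^ (β - 1) := by positivity
  have p3 : 0 < t ^ (β - 1) := by positivity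
  rcases h with h | h
  · have h1 : t / (2 * Q) ≤ w := by rw [div_le_iff₀ (by positivity)]; linarith
    have h2 := Real.rpow_le_rpow_of_nonpos (by positivity) h1 (show β - 1 ≤ 0 by linarith)
    rw [Real.div_rpow ht.le (by positivity)] at h2
    refine h2.trans ?_
    have e : t ^ (β - 1) / (2 * Q) ^ (β - 1) =
        (((2 * Q) ^ (β - 1))⁻¹ / β) * (β * t ^ (β - 1)) := by
      field_simp
    rw [e]
    gcongr
    · linarith
    · linarith
  · have h1 : η / Q ≤ w := by rw [div_le_iff₀ hQ]; linarith
    have h2 := Real.rpow_le_rpow_of_nonpos (by positivity) h1 (show β - 1 ≤ 0 by linarith)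
    refine h2.trans ?_
    have q1 : 0 < ((2 * Q) ^ (β - 1))⁻¹ / β := by positivity
    have q2 : 0 < β * t ^ (β - 1) := by positivity
    nlinarith [mul_pos q1 q2, mul_pos p2 q2]

theorem inv_sqrt_sub_one_le {t : ℝ} (h0 : 1 / 4 ≤ t) (h1 : t ≤ 1) :
    (√t)⁻¹ - 1 ≤ 2 * (1 - t) := by
  have h2 : 1 / 2 ≤ √t := (Real.le_sqrt' (by norm_num)).2 (by linarith)
  have h3 : √t ≤ 1 := Real.sqrt_le_one.2 h1
  have h4 := Real.sq_sqrt (show 0 ≤ t by linarith)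
  have h5 : 0 < √t := by linarith
  have h6 : (√t)⁻¹ ≤ 1 + 2 * (1 - t) := by
    rw [inv_le_iff_one_le_mul₀' h5, ← h4, Real.sqrt_sq h5.le]
    nlinarith [mul_nonneg (sub_nonneg.2 h3) (sub_nonneg.2 h2)]
  linarith

namespace SocialModel

variable {V : Type*} [Fintype V] {S R : ℕ} {Θ : Type*} [Fintype Θ]
  {Z : V → Type*} [∀ k, Fintype (Z k)] {M : SocialModel V S R Θ Z} {s : Fin S} {p : V → ℝ}

/-- The weighted lack of belief in the true state of a sending sub-network. -/
noncomputable def totalErr (M : SocialModel V S R Θ Z) (s : Fin S) (p : V → ℝ)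
    (b : V → Θ → ℝ) : ℝ :=
  ∑ k, p k * (1 - b k (M.truth (Sum.inl s)))

theorem IsPerron.mul_le_totalErr (hp : M.IsPerron s p) {b : V → Θ → ℝ}
    (hb : ∀ k, IsSubProb (b k)) (k : V) :
    p k * (1 - b k (M.truth (Sum.inl s))) ≤ M.totalErr s p b :=
  Finset.single_le_sum (f := fun k => p k * (1 - b k (M.truth (Sum.inl s))))
    (fun k _ => mul_nonneg (hp.nonneg k) (sub_nonneg.2 ((hb k).le_one _))) (Finset.mem_univ k)

theorem IsPerron.totalErr_nonneg (hp : M.IsPerron s p) {b : V → Θ → ℝ}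
    (hb : ∀ k, IsSubProb (b k)) : 0 ≤ M.totalErr s p b :=
  Finset.sum_nonneg fun k _ => mul_nonneg (hp.nonneg k) (sub_nonneg.2 ((hb k).le_one _))

/-- The Perron weights make diffusion preserve the total, so only the Bayes step costs a factor `2 /
ε`. -/
theorem IsPerron.totalErr_add_le (hp : M.IsPerron s p) {ε : ℝ} (hε : 0 < ε)
    (hL : ∀ k ζ, 0 < M.trueL k ζ → ε ≤ M.trueL k ζ) {x : ℕ → (k : V) → Z k}
    (hx : M.Feasible x) (i n : ℕ) :
    M.totalErr s p (M.belief x (i + n)) ≤ (2 / ε) ^ n * M.totalErr s p (M.belief x i) := by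
  induction n with
  | zero => simp
  | succ n ih =>
    rw [pow_succ', mul_assoc]
    refine le_trans ?_ (mul_le_mul_of_nonneg_left ih (by positivity))
    have h1 : ∀ k, 1 - M.belief x (i + n + 1) k (M.truth (Sum.inl s)) = ∑ l, M.A l k *
        (1 - M.bayes l (M.belief x (i + n) l) (x (i + n + 1) l) (M.truth (Sum.inl s))) := by
      intro k
      simp_rw [mul_sub, mul_one, Finset.sum_sub_distrib, M.sum_col]
      rfl
    rw [← add_assoc, totalErr]
    simp_rw [h1]
    rw [hp.sum_mul_sum, totalErr, Finset.mul_sum]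
    refine Finset.sum_le_sum fun l _ => ?_
    by_cases hl : M.sub l = Sum.inl s
    · rw [mul_left_comm]
      refine mul_le_mul_of_nonneg_left ?_ (hp.nonneg l)
      have hT : ∀ θ ∈ ({M.truth (Sum.inl s)} : Finset Θ), M.L l θ (x (i + n + 1) l) =
          M.trueL l (x (i + n + 1) l) := by
        simpa using L_truth_eq hl _
      simpa using one_sub_bayes_le (M.isSubProb_belief x (i + n) l) hT hε
        (hL _ _ (hx (i + n + 1) (by omega) l))
    · simp [hp.eq_zero l hl]

theorem IsPerron.potential_le_or (hp : M.IsPerron s p) {a : ℝ}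
    (ha : ∀ k, 0 < p k → a ≤ p k) {b : V → Θ → ℝ} (hb : ∀ k, IsSubProb (b k)) :
    M.potential s p b ≤ 2 * M.totalErr s p b ∨ a * (3 / 4) ≤ M.totalErr s p b := by
  -- On `[1 / 4, 1]` the potential is linearly bounded by the error; below `1 / 4` a single agent
  -- contributes at least `a * (3 / 4)` to the error.
  by_cases h : ∀ k, M.sub k = Sum.inl s → 1 / 4 ≤ b k (M.truth (Sum.inl s))
  · left
    rw [potential, totalErr, Finset.mul_sum]
    refine Finset.sum_le_sum fun k _ => ?_
    by_cases hk : M.sub k = Sum.inl s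
    · rw [mul_left_comm]
      exact mul_le_mul_of_nonneg_left (inv_sqrt_sub_one_le (h k hk) ((hb k).le_one _))
        (hp.nonneg k)
    · simp [hp.eq_zero k hk]
  · right
    push Not at h
    obtain ⟨k, hk, h⟩ := h
    refine le_trans ?_ (hp.mul_le_totalErr hb k)
    exact mul_le_mul (ha k (hp.pos k hk)) (by linarith) (by norm_num) (hp.nonneg k)

theorem IsPerron.potential_pos (hp : M.IsPerron s p) {b : V → Θ → ℝ}
    (hb : ∀ k, IsSubProb (b k))
    (hpos : ∀ k, M.sub k = Sum.inl s → 0 < b k (M.truth (Sum.inl s))) {l : V}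
    (hl : M.sub l = Sum.inl s) (hy : 0 < M.distMass l (b l)) : 0 < M.potential s p b := by
  refine (hp.potential_nonneg hb hpos).lt_of_ne' fun h0 => hy.not_ge ?_
  have h1 := hp.eq_one_of_potential_eq_zero hb hpos h0 hl
  have h2 := distMass_le_one_sub (M := M) (hb l) (θ := M.truth (Sum.inl s))
    fun ζ => L_truth_eq hl ζ
  linarith

/-- The lack of belief in the true state at some time is controlled by the decrease of the
potential a few steps later. -/
theorem IsPerron.exists_rpow_mul_sq_le_drop (hp : M.IsPerron s p)
    (hident : (⋂ k ∈ {k | M.sub k = Sum.inl s}, M.indist k) = {M.truth (Sum.inl s)})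
    {β : ℝ} (hβ0 : 0 < β) (hβ1 : β < 1) {k : V} (hk : M.sub k = Sum.inl s) {θ : Θ}
    (hθ : θ ≠ M.truth (Sum.inl s)) :
    ∃ n K, 0 ≤ K ∧ ∀ x, M.Feasible x → ∀ i,
      (∀ k, M.sub k = Sum.inl s → 0 < M.belief x (i + n) k (M.truth (Sum.inl s))) →
      0 < M.totalErr s p (M.belief x i) →
      M.totalErr s p (M.belief x i) ^ (β - 1) * (p k * M.belief x i k θ) ^ 2 ≤
        K * M.drop s p β (M.belief x (i + n)) := by
  obtain ⟨ε, hε, -, hL⟩ := M.exists_pos_le_trueL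
  obtain ⟨a, ha0, -, ha⟩ := exists_pos_le_of_finite p
  obtain ⟨n, l, c, hl, hc, h⟩ := exists_belief_le_distMass hident hk hθ
  have hpl := hp.pos l hl
  set Q := (2 / ε) ^ n with hQ
  set K₁ := ((2 * Q) ^ (β - 1))⁻¹ / β + (a * (3 / 4) / Q) ^ (β - 1) with hK₁
  have hK₁0 : 0 ≤ K₁ := by positivity
  refine ⟨n, K₁ * ((p k / c) ^ 2 / p l), by positivity, fun x hx i hpos hW => ?_⟩
  have hb := M.isSubProb_belief x (i + n)
  have hy := h x hx i
  have hy0 := distMass_nonneg (M := M) (k := l) (hb l)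
  set y := M.distMass l (M.belief x (i + n) l) with hydef
  have hμ0 := (M.isSubProb_belief x i k).1 θ
  have h1 : (p k * M.belief x i k θ) ^ 2 ≤ (p k / c) ^ 2 * y ^ 2 := by
    rw [← mul_pow]
    refine pow_le_pow_left₀ (mul_nonneg (hp.nonneg k) hμ0) ?_ 2
    rw [div_mul_eq_mul_div, mul_div_assoc]
    refine mul_le_mul_of_nonneg_left ?_ (hp.nonneg k)
    rw [le_div_iff₀ hc]
    linarith
  rcases hy0.eq_or_lt with hy' | hy'
  · rw [← hy'] at h1
    have h2 : (p k * M.belief x i k θ) ^ 2 = 0 :=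
      le_antisymm (by simpa using h1) (sq_nonneg _)
    rw [h2, mul_zero]
    exact mul_nonneg (by positivity) (drop_nonneg hp hβ0 hb hpos)
  · have hX := hp.potential_pos hb hpos hl hy'
    have h2 := rpow_sub_one_le_mul hβ0 hβ1 hX (show 0 < Q by positivity)
      (show 0 < a * (3 / 4) by positivity) (hp.totalErr_add_le hε hL hx i n)
      (hp.potential_le_or ha hb)
    have h3 : p l * y ^ 2 ≤ ∑ l, p l * M.distMass l (M.belief x (i + n) l) ^ 2 :=
      Finset.single_le_sum (f := fun l => p l * M.distMass l (M.belief x (i + n) l) ^ 2)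
        (fun l _ => mul_nonneg (hp.nonneg l) (sq_nonneg _)) (Finset.mem_univ l)
    have hφ : 0 ≤ 1 + β * M.potential s p (M.belief x (i + n)) ^ (β - 1) := by positivity
    calc _ ≤ K₁ * (1 + β * M.potential s p (M.belief x (i + n)) ^ (β - 1)) *
          ((p k / c) ^ 2 * y ^ 2) :=
        mul_le_mul h2 h1 (sq_nonneg _) (mul_nonneg hK₁0 hφ)
      _ = K₁ * ((p k / c) ^ 2 / p l) *
          ((1 + β * M.potential s p (M.belief x (i + n)) ^ (β - 1)) * (p l * y ^ 2)) := by
        field_simp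
      _ ≤ _ := mul_le_mul_of_nonneg_left (mul_le_mul_of_nonneg_left h3 hφ) (by positivity)

theorem sum_belief_succ_eq_one {x : ℕ → (k : V) → Z k} (hx : M.Feasible x) {i : ℕ}
    (hpos : ∀ k, M.sub k = Sum.inl s → 0 < M.belief x i k (M.truth (Sum.inl s))) {k : V}
    (hk : M.sub k = Sum.inl s) : ∑ θ, M.belief x (i + 1) k θ = 1 := by
  rw [sum_belief_succ, ← M.sum_col k]
  refine Finset.sum_congr rfl fun l _ => ?_
  rcases (M.nonneg l k).eq_or_lt with h | h
  · simp [← h]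
  · have hl := sub_eq_of_A_pos hk h
    rw [sum_bayes_eq_one, mul_one]
    exact (evidence_pos (M.isSubProb_belief x i l) (hpos l hl)
      ((L_truth_eq hl _).symm ▸ hx (i + 1) (by omega) l)).ne'

theorem IsPerron.totalErr_rpow_le (hp : M.IsPerron s p)
    (hident : (⋂ k ∈ {k | M.sub k = Sum.inl s}, M.indist k) = {M.truth (Sum.inl s)})
    (hprior : ∃ k, M.sub k = Sum.inl s ∧ 0 < M.prior k (M.truth (Sum.inl s)))
    {β : ℝ} (hβ0 : 0 < β) (hβ1 : β < 1) :
    ∃ (n : V → Θ → ℕ) (K : V → Θ → ℝ), ∀ᶠ i in atTop, ∀ x, M.Feasible x →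
      M.totalErr s p (M.belief x i) ^ (1 + β) ≤
        ∑ k, ∑ θ, K k θ * M.drop s p β (M.belief x (i + n k θ)) := by
  classical
  have h : ∀ k θ, ∃ n K, 0 ≤ K ∧ (M.sub k = Sum.inl s → θ ≠ M.truth (Sum.inl s) →
      ∀ x, M.Feasible x → ∀ i,
      (∀ k, M.sub k = Sum.inl s → 0 < M.belief x (i + n) k (M.truth (Sum.inl s))) →
      0 < M.totalErr s p (M.belief x i) →
      M.totalErr s p (M.belief x i) ^ (β - 1) * (p k * M.belief x i k θ) ^ 2 ≤
        K * M.drop s p β (M.belief x (i + n))) := by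
    intro k θ
    by_cases hk : M.sub k = Sum.inl s ∧ θ ≠ M.truth (Sum.inl s)
    · obtain ⟨n, K, hK, h⟩ := hp.exists_rpow_mul_sq_le_drop hident hβ0 hβ1 hk.1 hk.2
      exact ⟨n, K, hK, fun _ _ => h⟩
    · exact ⟨0, 0, le_rfl, fun h1 h2 => absurd ⟨h1, h2⟩ hk⟩
  choose n K hK0 hK using h
  obtain ⟨i₀, hi₀⟩ := eventually_atTop.1 (eventually_belief_pos hprior)
  -- The cardinality comes from Cauchy–Schwarz. The time `i₀ + 1` ensures positive beliefs one step
  -- earlier, so that beliefs sum to 1 and the error is exactly the mass of the false states.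
  refine ⟨n, fun k θ => Fintype.card (V × Θ) * K k θ,
    eventually_atTop.2 ⟨i₀ + 1, fun i hi x hx => ?_⟩⟩
  have hdrop : ∀ m, 0 ≤ M.drop s p β (M.belief x (i + m)) := fun m =>
    drop_nonneg hp hβ0 (M.isSubProb_belief x _) fun k hk => hi₀ (i + m) (by omega) k hk x hx
  rcases (hp.totalErr_nonneg (M.isSubProb_belief x i)).eq_or_lt with h0 | h0
  · rw [← h0, Real.zero_rpow (by linarith)]
    exact Finset.sum_nonneg fun k _ => Finset.sum_nonneg fun θ _ =>
      mul_nonneg (mul_nonneg (Nat.cast_nonneg _) (hK0 k θ)) (hdrop _)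
  let t : V × Θ → ℝ := fun z =>
    if z.2 = M.truth (Sum.inl s) then 0 else p z.1 * M.belief x i z.1 z.2
  have hW : M.totalErr s p (M.belief x i) = ∑ z, t z := by
    rw [Fintype.sum_prod_type, totalErr]
    refine Finset.sum_congr rfl fun k _ => ?_
    by_cases hk : M.sub k = Sum.inl s
    · have h1 : ∑ θ, M.belief x i k θ = 1 := by
        obtain ⟨j, rfl⟩ := Nat.exists_eq_succ_of_ne_zero (show i ≠ 0 by omega)
        exact sum_belief_succ_eq_one hx (fun k hk => hi₀ j (by omega) k hk x hx) hk
      rw [← h1, ← Finset.sum_erase_eq_sub (Finset.mem_univ _), Finset.mul_sum]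
      simp only [t]
      rw [Finset.sum_ite, Finset.sum_const_zero, zero_add]
      refine Finset.sum_congr ?_ fun _ _ => rfl
      ext θ
      simp
    · simp [t, hp.eq_zero k hk]
  have hterm : ∀ z, M.totalErr s p (M.belief x i) ^ (β - 1) * t z ^ 2 ≤
      K z.1 z.2 * M.drop s p β (M.belief x (i + n z.1 z.2)) := by
    rintro ⟨k, θ⟩
    by_cases hk : M.sub k = Sum.inl s ∧ θ ≠ M.truth (Sum.inl s)
    · simpa [t, hk.2] using hK k θ hk.1 hk.2 x hx i
        (fun k hk => hi₀ _ (by omega) k hk x hx) h0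
    · have : t (k, θ) = 0 := by
        by_cases hk' : M.sub k = Sum.inl s
        · have : θ = M.truth (Sum.inl s) := by_contra fun h => hk ⟨hk', h⟩
          simp [t, this]
        · simp [t, hp.eq_zero k hk']
      rw [this]
      simpa using mul_nonneg (hK0 k θ) (hdrop _)
  have hsq : M.totalErr s p (M.belief x i) ^ 2 ≤ Fintype.card (V × Θ) * ∑ z, t z ^ 2 := by
    rw [hW]
    exact sq_sum_le_card_mul_sum_sq
  have e : M.totalErr s p (M.belief x i) ^ (1 + β) =
      M.totalErr s p (M.belief x i) ^ (β - 1) * M.totalErr s p (M.belief x i) ^ 2 := by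
    rw [← Real.rpow_natCast, ← Real.rpow_add h0]
    congr 1
    push_cast
    ring
  rw [e]
  refine (mul_le_mul_of_nonneg_left hsq (Real.rpow_nonneg h0.le _)).trans ?_
  rw [mul_left_comm, Finset.mul_sum, Finset.mul_sum, ← Fintype.sum_prod_type']
  refine Finset.sum_le_sum fun z _ => ?_
  rw [mul_assoc]
  exact mul_le_mul_of_nonneg_left (hterm z) (Nat.cast_nonneg _)

theorem exists_sum_trueL_mul_inv_sqrt_bayes_le
    (hprev : ∀ k, M.sub k = Sum.inl s → ∃ ζ, M.IsPrevailing k ζ) :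
    ∃ c, 0 < c ∧ ∀ k, M.sub k = Sum.inl s → ∀ μ, IsSubProb μ → 0 < μ (M.truth (Sum.inl s)) →
      ∑ ζ, M.trueL k ζ * (√(M.bayes k μ ζ (M.truth (Sum.inl s))))⁻¹ ≤
        (√(μ (M.truth (Sum.inl s))))⁻¹ - c * M.distMass k μ ^ 2 := by
  have h : ∀ k, ∃ c, 0 < c ∧ (M.sub k = Sum.inl s → ∀ μ, IsSubProb μ →
      0 < μ (M.truth (Sum.inl s)) →
      ∑ ζ, M.trueL k ζ * (√(M.bayes k μ ζ (M.truth (Sum.inl s))))⁻¹ ≤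
        (√(μ (M.truth (Sum.inl s))))⁻¹ - c * M.distMass k μ ^ 2) := by
    intro k
    by_cases hk : M.sub k = Sum.inl s
    · obtain ⟨ζ, hζ⟩ := hprev k hk
      obtain ⟨δ, hδ0, hδ⟩ := hζ.exists_gap
      exact ⟨δ ^ 2 / 8, by positivity, fun _ μ h hμ =>
        sum_trueL_mul_inv_sqrt_bayes_le hk hδ0.le hδ h hμ⟩
    · exact ⟨1, one_pos, fun h => absurd h hk⟩
  choose c hc0 hc using h
  obtain ⟨c₀, h0, -, hc₀⟩ := exists_pos_le_of_finite c
  refine ⟨c₀, h0, fun k hk μ h hμ => (hc k hk μ h hμ).trans ?_⟩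
  have := mul_le_mul_of_nonneg_right (hc₀ k (hc0 k)) (sq_nonneg (M.distMass k μ))
  linarith

/-! ### Expected decrease of the potential and summability for sending agents. -/

variable [∀ k, MeasurableSpace (Z k)] [∀ k, MeasurableSingletonClass (Z k)]
  {Ω : Type*} [MeasurableSpace Ω] {P : Measure Ω} [IsProbabilityMeasure P]
  {ξ : ℕ → Ω → (k : V) → Z k}

theorem IsSignalSequence.integrable_belief (hξ : M.IsSignalSequence P ξ) (n : ℕ)
    (f : (V → Θ → ℝ) → ℝ) : Integrable (fun ω => f (M.belief (fun j => ξ j ω) n)) P :=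
  hξ.integrable (adapted_belief n f)

/-- The expectation of a concave function of the potential decreases. -/
theorem IsSignalSequence.integral_potential_succ_le (hξ : M.IsSignalSequence P ξ)
    (hp : M.IsPerron s p) {c : ℝ}
    (hc : ∀ k, M.sub k = Sum.inl s → ∀ μ, IsSubProb μ → 0 < μ (M.truth (Sum.inl s)) →
      ∑ ζ, M.trueL k ζ * (√(M.bayes k μ ζ (M.truth (Sum.inl s))))⁻¹ ≤
        (√(μ (M.truth (Sum.inl s))))⁻¹ - c * M.distMass k μ ^ 2)
    {β : ℝ} (hβ0 : 0 < β) (hβ1 : β < 1) {i : ℕ}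
    (hpos : ∀ k, M.sub k = Sum.inl s → ∀ x, M.Feasible x →
      0 < M.belief x i k (M.truth (Sum.inl s)))
    (hpos' : ∀ k, M.sub k = Sum.inl s → ∀ x, M.Feasible x →
      0 < M.belief x (i + 1) k (M.truth (Sum.inl s))) :
    ∫ ω, (M.potential s p (M.belief (fun j => ξ j ω) (i + 1)) +
        M.potential s p (M.belief (fun j => ξ j ω) (i + 1)) ^ β) ∂P ≤
      ∫ ω, (M.potential s p (M.belief (fun j => ξ j ω) i) +
        M.potential s p (M.belief (fun j => ξ j ω) i) ^ β) ∂P -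
      c * ∫ ω, M.drop s p β (M.belief (fun j => ξ j ω) i) ∂P := by
  set θ₀ := M.truth (Sum.inl s) with hθ₀
  -- The tangent slope depends on the past only, so it can multiply the next Bayes update before
  -- averaging over the new signal.
  let slope : (V → Θ → ℝ) → ℝ := fun b => 1 + β * M.potential s p b ^ (β - 1)
  let G : (l : V) → Z l → (ℕ → (k : V) → Z k) → ℝ := fun l ζ x =>
    slope (M.belief x i) * (√(M.bayes l (M.belief x i l) ζ θ₀))⁻¹
  have hG : ∀ l ζ, PathAdapted i (G l ζ) := fun l ζ =>
    adapted_belief i fun b => slope b * (√(M.bayes l (b l) ζ θ₀))⁻¹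
  have hG' : ∀ l, Integrable (fun ω => G l (ξ (i + 1) ω l) fun j => ξ j ω) P := by
    intro l
    refine hξ.integrable (n := i + 1) (F := fun x => G l (x (i + 1) l) x) fun x y hxy => ?_
    beta_reduce
    rw [hxy (i + 1) (by omega) le_rfl]
    exact hG l _ x y fun j h1 h2 => hxy j h1 (by omega)
  have hI := hξ.integrable_belief i
  have hstep : ∀ l, p l * ∫ ω, G l (ξ (i + 1) ω l) (fun j => ξ j ω) ∂P ≤
      p l * ∫ ω, slope (M.belief (fun j => ξ j ω) i) *
        ((√(M.belief (fun j => ξ j ω) i l θ₀))⁻¹ -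
          c * M.distMass l (M.belief (fun j => ξ j ω) i l) ^ 2) ∂P := by
    intro l
    by_cases hl : M.sub l = Sum.inl s
    swap
    · simp [hp.eq_zero l hl]
    refine mul_le_mul_of_nonneg_left ?_ (hp.nonneg l)
    rw [hξ.integral_step l (hG l)]
    refine integral_mono_ae
      (integrable_finsetSum _ fun ζ _ => (hξ.integrable (hG l ζ)).const_mul _)
      (hI fun b => slope b * ((√(b l θ₀))⁻¹ - c * M.distMass l (b l) ^ 2)) ?_
    filter_upwards [hξ.ae_feasible] with ω hω
    simp only [G, mul_left_comm (M.trueL _ _), ← Finset.mul_sum]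
    refine mul_le_mul_of_nonneg_left
      (hc l hl _ (M.isSubProb_belief _ i l) (hpos l hl _ hω)) ?_
    have := Real.rpow_nonneg (hp.potential_nonneg (M.isSubProb_belief (fun j => ξ j ω) i)
      fun k hk => hpos k hk _ hω) (β - 1)
    simp only [slope]
    positivity
  have hpath : ∀ᵐ ω ∂P, M.potential s p (M.belief (fun j => ξ j ω) (i + 1)) +
        M.potential s p (M.belief (fun j => ξ j ω) (i + 1)) ^ β ≤
      (M.potential s p (M.belief (fun j => ξ j ω) i) +
        M.potential s p (M.belief (fun j => ξ j ω) i) ^ β) +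
      ((∑ l, p l * G l (ξ (i + 1) ω l) fun j => ξ j ω) -
        ∑ l, p l * (slope (M.belief (fun j => ξ j ω) i) *
          (√(M.belief (fun j => ξ j ω) i l θ₀))⁻¹)) := by
    filter_upwards [hξ.ae_feasible] with ω hω
    refine (hp.concave_potential_succ_le hω hβ0 hβ1 (fun k hk => hpos k hk _ hω)
      fun k hk => hpos' k hk _ hω).trans_eq ?_
    congr 1
    conv_lhs => rw [potential, ← Finset.sum_sub_distrib, Finset.mul_sum]
    rw [← Finset.sum_sub_distrib]
    refine Finset.sum_congr rfl fun l _ => ?_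
    simp only [G, slope, potential]
    ring
  have hI1 : Integrable (fun ω => ∑ l, p l * G l (ξ (i + 1) ω l) fun j => ξ j ω) P :=
    integrable_finsetSum _ fun l _ => (hG' l).const_mul _
  have hI2 : ∀ l, Integrable (fun ω => slope (M.belief (fun j => ξ j ω) i) *
      (√(M.belief (fun j => ξ j ω) i l θ₀))⁻¹) P :=
    fun l => hI fun b => slope b * (√(b l θ₀))⁻¹
  have hI3 : Integrable (fun ω => ∑ l, p l * (slope (M.belief (fun j => ξ j ω) i) *
      (√(M.belief (fun j => ξ j ω) i l θ₀))⁻¹)) P :=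
    integrable_finsetSum _ fun l _ => (hI2 l).const_mul _
  have hI4 := hI fun b => M.potential s p b + M.potential s p b ^ β
  have hI5 : ∀ l, Integrable (fun ω => slope (M.belief (fun j => ξ j ω) i) *
      M.distMass l (M.belief (fun j => ξ j ω) i l) ^ 2) P :=
    fun l => hI fun b => slope b * M.distMass l (b l) ^ 2
  refine (integral_mono_ae (hξ.integrable_belief (i + 1)
    fun b => M.potential s p b + M.potential s p b ^ β)
    (hI4.add (hI1.sub hI3)) hpath).trans ?_
  rw [integral_add' hI4 (hI1.sub hI3), integral_sub' hI1 hI3,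
    integral_finsetSum _ fun l _ => (hG' l).const_mul _,
    integral_finsetSum _ fun l _ => (hI2 l).const_mul _, sub_eq_add_neg (∫ _, _ ∂P)]
  refine add_le_add le_rfl ?_
  have hdrop : ∫ ω, M.drop s p β (M.belief (fun j => ξ j ω) i) ∂P =
      ∑ l, p l * ∫ ω, slope (M.belief (fun j => ξ j ω) i) *
        M.distMass l (M.belief (fun j => ξ j ω) i l) ^ 2 ∂P := by
    simp_rw [← integral_const_mul]
    rw [← integral_finsetSum _ fun l _ => (hI5 l).const_mul _]
    refine integral_congr_ae (ae_of_all _ fun ω => ?_)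
    simp only [drop, slope, Finset.mul_sum]
    exact Finset.sum_congr rfl fun l _ => by ring
  rw [hdrop, Finset.mul_sum, ← Finset.sum_sub_distrib, ← Finset.sum_neg_distrib]
  refine Finset.sum_le_sum fun l _ => ?_
  have h1 := hstep l
  simp_rw [mul_sub] at h1
  rw [integral_sub (hI2 l) (by simpa only [mul_left_comm] using (hI5 l).const_mul c)] at h1
  simp_rw [mul_left_comm _ c] at h1
  rw [integral_const_mul] at h1
  rw [integral_const_mul, integral_const_mul]
  linarith

/-- The decreases telescope and the potential stays nonnegative. The sum starts at a deterministic
time after which beliefs in the true state are positive on every feasible path. -/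
theorem IsSignalSequence.summable_integral_drop (hξ : M.IsSignalSequence P ξ)
    (hp : M.IsPerron s p)
    (hprior : ∃ k, M.sub k = Sum.inl s ∧ 0 < M.prior k (M.truth (Sum.inl s)))
    (hprev : ∀ k, M.sub k = Sum.inl s → ∃ ζ, M.IsPrevailing k ζ)
    {β : ℝ} (hβ0 : 0 < β) (hβ1 : β < 1) :
    Summable fun i => ∫ ω, M.drop s p β (M.belief (fun j => ξ j ω) i) ∂P := by
  obtain ⟨c, hc0, hc⟩ := exists_sum_trueL_mul_inv_sqrt_bayes_le hprev
  obtain ⟨i₀, hi₀⟩ := eventually_atTop.1 (eventually_belief_pos hprior)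
  rw [← summable_nat_add_iff i₀]
  let a : ℕ → ℝ := fun i => ∫ ω, (M.potential s p (M.belief (fun j => ξ j ω) (i + i₀)) +
    M.potential s p (M.belief (fun j => ξ j ω) (i + i₀)) ^ β) ∂P
  have ha0 : ∀ i, 0 ≤ a i := by
    intro i
    refine integral_nonneg_of_ae ?_
    filter_upwards [hξ.ae_feasible] with ω hω
    have := hp.potential_nonneg (M.isSubProb_belief (fun j => ξ j ω) (i + i₀))
      fun k hk => hi₀ _ (by omega) k hk _ hω
    simp only [Pi.zero_apply]
    positivity
  have hstep : ∀ i, c * ∫ ω, M.drop s p β (M.belief (fun j => ξ j ω) (i + i₀)) ∂P ≤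
      a i - a (i + 1) := by
    intro i
    have := hξ.integral_potential_succ_le hp hc hβ0 hβ1 (hi₀ (i + i₀) (by omega))
      (hi₀ (i + i₀ + 1) (by omega))
    simp only [a]
    rw [add_right_comm i 1 i₀]
    linarith
  refine summable_of_sum_range_le (c := a 0 / c) (fun i => ?_) fun N => ?_
  · refine integral_nonneg_of_ae ?_
    filter_upwards [hξ.ae_feasible] with ω hω
    exact drop_nonneg hp hβ0 (M.isSubProb_belief _ _)
      fun k hk => hi₀ _ (by omega) k hk _ hω
  · rw [le_div_iff₀ hc0, mul_comm, Finset.mul_sum]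
    refine (Finset.sum_le_sum fun i _ => hstep i).trans ?_
    rw [Finset.sum_range_sub']
    linarith [ha0 N]

/-- The lack of belief of a sending agent in its true state has summable moments of all orders
above one. -/
theorem IsSignalSequence.summable_integral_err_rpow (hξ : M.IsSignalSequence P ξ)
    (hprior : ∃ k, M.sub k = Sum.inl s ∧ 0 < M.prior k (M.truth (Sum.inl s)))
    (hprev : ∀ k, M.sub k = Sum.inl s → ∃ ζ, M.IsPrevailing k ζ)
    (hident : (⋂ k ∈ {k | M.sub k = Sum.inl s}, M.indist k) = {M.truth (Sum.inl s)})
    {β : ℝ} (hβ0 : 0 < β) (hβ1 : β < 1) {k : V} (hk : M.sub k = Sum.inl s) :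
    Summable fun i => ∫ ω, M.err (fun j => ξ j ω) i k ^ (1 + β) ∂P := by
  obtain ⟨p, hp⟩ := M.exists_isPerron s
  obtain ⟨n, K, hK⟩ := hp.totalErr_rpow_le hident hprior hβ0 hβ1
  have hD := hξ.summable_integral_drop hp hprior hprev hβ0 hβ1
  have hpk : 0 < p k ^ (1 + β) := Real.rpow_pos_of_pos (hp.pos k hk) _
  have hsum : Summable fun i => (p k ^ (1 + β))⁻¹ * ∑ l, ∑ θ, K l θ *
      ∫ ω, M.drop s p β (M.belief (fun j => ξ j ω) (i + n l θ)) ∂P :=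
    (summable_sum fun l _ => summable_sum fun θ _ =>
      ((summable_nat_add_iff (n l θ)).2 hD).mul_left _).mul_left _
  refine hsum.of_norm_bounded_eventually_nat (hK.mono fun i hi => ?_)
  rw [Real.norm_of_nonneg (integral_nonneg fun ω => Real.rpow_nonneg (M.err_nonneg _ i k) _),
    inv_mul_eq_div, le_div_iff₀ hpk, mul_comm, ← integral_const_mul]
  have hI : ∀ l θ, Integrable (fun ω => K l θ *
      M.drop s p β (M.belief (fun j => ξ j ω) (i + n l θ))) P :=
    fun l θ => (hξ.integrable_belief _ (M.drop s p β)).const_mul _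
  simp_rw [← integral_const_mul]
  simp_rw [← integral_finsetSum _ fun θ _ => hI _ θ]
  rw [← integral_finsetSum _ fun l _ => integrable_finsetSum _ fun θ _ => hI l θ]
  refine integral_mono_ae ((hξ.integrable (pathAdapted_err_rpow i k _)).const_mul _)
    (integrable_finsetSum _ fun l _ => integrable_finsetSum _ fun θ _ => hI l θ) ?_
  filter_upwards [hξ.ae_feasible] with ω hω
  refine le_trans ?_ (hi _ hω)
  rw [← Real.mul_rpow (hp.nonneg k) (M.err_nonneg _ i k)]
  refine Real.rpow_le_rpow (mul_nonneg (hp.nonneg k) (M.err_nonneg _ i k)) ?_ (by linarith)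
  simpa [err, target_of_sending M hk] using
    hp.mul_le_totalErr (M.isSubProb_belief (fun j => ξ j ω) i) k

end SocialModel

/-! ### Conclusion. -/

theorem lemma3 {V : Type*} [Fintype V] {S R : ℕ} {Θ : Type*} [Fintype Θ]
    {Z : V → Type*} [∀ k, Fintype (Z k)]
    [∀ k, MeasurableSpace (Z k)] [∀ k, MeasurableSingletonClass (Z k)]
    (M : SocialModel V S R Θ Z)
    {Ω : Type*} [MeasurableSpace Ω] (P : Measure Ω) [IsProbabilityMeasure P]
    (ξ : ℕ → Ω → (k : V) → Z k) (hξ : M.IsSignalSequence P ξ)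
    -- in each sending sub-network, some agent has a positive prior belief in the true state,
    (hprior : ∀ s : Fin S, ∃ k, M.sub k = Sum.inl s ∧ 0 < M.prior k (M.truth (Sum.inl s)))
    -- each agent has a prevailing signal,
    (hprev : ∀ (s : Fin S) (k : V), M.sub k = Sum.inl s → ∃ ζ, M.IsPrevailing k ζ)
    -- and the true state is globally identifiable
    (hident : ∀ s : Fin S, (⋂ k ∈ {k | M.sub k = Sum.inl s}, M.indist k) = {M.truth (Sum.inl s)})
    -- receiving agents cannot distinguish the true states of the sending sub-networks from their own
    (himp : ∀ (r : Fin R) (k : V), M.sub k = Sum.inr r →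
      ∀ s : Fin S, M.truth (Sum.inl s) ∈ M.indist k) :
    ∀ (r : Fin R) (k : V), M.sub k = Sum.inr r → ∀ θ : Θ, θ ∉ M.sendingTruths →
      ∀ᵐ ω ∂P, Tendsto (fun i => M.belief (fun j => ξ j ω) i k θ) atTop (𝓝 0) := by
  have hT : ∀ k, ∀ θ ∈ M.target k, ∀ ζ, M.L k θ ζ = M.trueL k ζ :=
    fun k θ hθ ζ => M.L_eq_of_mem_target himp hθ ζ
  intro r k hk θ hθ
  filter_upwards [hξ.ae_tendsto_err hT (fun β hβ0 hβ1 l s hl =>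
    hξ.summable_integral_err_rpow (hprior s) (hprev s) (hident s) hβ0 hβ1 hl) k] with ω hω
  exact squeeze_zero (fun i => (M.isSubProb_belief _ i k).1 θ)
    (fun i => M.belief_le_err _ i k fun h => hθ ((M.mem_target_of_receiving hk).1 h)) hω
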